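/- Let $n\ge 1$ and $d\ge 1$, and let $f\in\mathbb{C}[x_0,\dots,x_n]$ be a homogeneous polynomial of degree $d$ whose zero locus $M=\{f=0\}\subset\mathbb{P}^n=\mathbb{CP}^n$ is smooth, i.e. there is no $z\in\mathbb{C}^{n+1}\setminus\{0\}$ with $f(z)=0$ and $\partial f/\partial x_i(z)=0$ for all $i$. Then $M$ is a (non-empty, Hausdorff) compact complex manifold of dimension $n-1$, holomorphically embedded in $\mathbb{P}^n$. The restriction to $M$ of the Fubini--Study form $\frac{i}{2\pi}\partial\bar\partial\log|z|^2$ is the fundamental form of a Kähler metric on $M$, and $$c_1(T_M)=(n+1-d)\,H\quad\text{in } H^2(M;\mathbb{R}),$$ where $H$ is the restriction to $M$ of the hyperplane class of $\mathbb{P}^n$, i.e. the class of that form. In particular, if $d=n+1$, then $M$ is a Calabi--Yau $(n-1)$-fold: a compact complex manifold of dimension $n-1$ that admits a Kähler metric and satisfies $c_1(T_M)=0$ in $H^2(M;\mathbb{R})$. -/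

import Mathlib

open scoped ContDiff Manifold Topology ComplexOrder LinearAlgebra.Projectivization

noncomputable section

/-! ### Complex projective space as a complex manifold -/

/-- Complex projective space `ℙⁿ`: lines through the origin in `ℂⁿ⁺¹`. -/
abbrev CP (n : ℕ) : Type := ℙ ℂ (Fin (n + 1) → ℂ)

/-- The quotient topology from `ℂⁿ⁺¹ ∖ {0}`. -/
instance CP.instTopologicalSpace (n : ℕ) : TopologicalSpace (CP n) :=
  TopologicalSpace.coinduced (Projectivization.mk' ℂ) inferInstance

theorem CP.isQuotientMap_mk (n : ℕ) :
    Topology.IsQuotientMap (Projectivization.mk' ℂ : {v : Fin (n + 1) → ℂ // v ≠ 0} → CP n) :=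
  ⟨⟨rfl⟩, Quotient.mk''_surjective⟩

theorem CP.rep_mk {n : ℕ} (v : Fin (n + 1) → ℂ) (hv : v ≠ 0) :
    ∃ a : ℂ, a ≠ 0 ∧ (Projectivization.mk ℂ v hv).rep = a • v := by
  obtain ⟨a, ha⟩ := Projectivization.exists_smul_eq_mk_rep ℂ v hv
  exact ⟨a, a.ne_zero, ha.symm⟩

theorem CP.rep_mk_ne_zero_iff {n : ℕ} (v : Fin (n + 1) → ℂ) (hv : v ≠ 0) (i : Fin (n + 1)) :
    (Projectivization.mk ℂ v hv).rep i ≠ 0 ↔ v i ≠ 0 := by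
  obtain ⟨a, ha, h⟩ := CP.rep_mk v hv
  simp [h, ha]

theorem CP.rep_mk_div {n : ℕ} (v : Fin (n + 1) → ℂ) (hv : v ≠ 0) (i j : Fin (n + 1)) :
    (Projectivization.mk ℂ v hv).rep j / (Projectivization.mk ℂ v hv).rep i = v j / v i := by
  obtain ⟨a, ha, h⟩ := CP.rep_mk v hv
  simp [h, mul_div_mul_left _ _ ha]

theorem CP.insertNth_ne_zero {n : ℕ} (i : Fin (n + 1)) (w : Fin n → ℂ) :
    (i.insertNth (1 : ℂ) w : Fin (n + 1) → ℂ) ≠ 0 := fun h => by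
  simpa using congrFun h i

theorem CP.isOpen_chart_source {n : ℕ} (i : Fin (n + 1)) :
    IsOpen {p : CP n | p.rep i ≠ 0} := by
  rw [← (CP.isQuotientMap_mk n).isOpen_preimage]
  have : (Projectivization.mk' ℂ : {v : Fin (n + 1) → ℂ // v ≠ 0} → CP n) ⁻¹'
      {p : CP n | p.rep i ≠ 0} = {v | v.1 i ≠ 0} := by
    ext v
    exact CP.rep_mk_ne_zero_iff v.1 v.2 i
  rw [this]
  exact isOpen_ne_fun ((continuous_apply i).comp continuous_subtype_val) continuous_const

/-- The affine chart `[z₀ : … : zₙ] ↦ (z_k / z_i)_{k ≠ i}` on `{z_i ≠ 0}`. -/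
def CP.chart {n : ℕ} (i : Fin (n + 1)) : OpenPartialHomeomorph (CP n) (Fin n → ℂ) where
  toFun p := fun k => p.rep (i.succAbove k) / p.rep i
  invFun w := Projectivization.mk ℂ (i.insertNth (1 : ℂ) w) (CP.insertNth_ne_zero i w)
  source := {p | p.rep i ≠ 0}
  target := Set.univ
  map_source' _ _ := Set.mem_univ _
  map_target' w _ := by
    refine (CP.rep_mk_ne_zero_iff _ (CP.insertNth_ne_zero i w) i).2 ?_
    simp
  left_inv' p hp := by
    conv_rhs => rw [← p.mk_rep]
    rw [Projectivization.mk_eq_mk_iff']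
    refine ⟨(p.rep i)⁻¹, ?_⟩
    ext k
    refine Fin.succAboveCases i ?_ (fun k => ?_) k
    · simpa using inv_mul_cancel₀ hp
    · simp [div_eq_inv_mul]
  right_inv' w _ := by
    ext k
    rw [CP.rep_mk_div]
    simp
  open_source := CP.isOpen_chart_source i
  open_target := isOpen_univ
  continuousOn_toFun := by
    rw [(CP.isQuotientMap_mk n).continuousOn_isOpen_iff (CP.isOpen_chart_source i)]
    have h : ContinuousOn (fun v : {v : Fin (n + 1) → ℂ // v ≠ 0} =>
        fun k => v.1 (i.succAbove k) / v.1 i)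
        ((Projectivization.mk' ℂ : {v : Fin (n + 1) → ℂ // v ≠ 0} → CP n) ⁻¹'
          {p : CP n | p.rep i ≠ 0}) := by
      refine continuousOn_pi.2 fun k => ContinuousOn.div
        ((continuous_apply _).comp continuous_subtype_val).continuousOn
        ((continuous_apply _).comp continuous_subtype_val).continuousOn ?_
      intro v hv
      exact (CP.rep_mk_ne_zero_iff v.1 v.2 i).1 hv
    refine h.congr fun v _ => ?_
    ext k
    exact CP.rep_mk_div v.1 v.2 i _
  continuousOn_invFun := by
    refine Continuous.continuousOn ?_
    have h : Continuous (fun w : Fin n → ℂ =>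
        (⟨i.insertNth (1 : ℂ) w, CP.insertNth_ne_zero i w⟩ : {v : Fin (n + 1) → ℂ // v ≠ 0})) := by
      refine Continuous.subtype_mk ?_ _
      refine continuous_pi fun k => Fin.succAboveCases i ?_ (fun k => ?_) k
      · simpa using continuous_const
      · simpa using continuous_apply k
    exact (CP.isQuotientMap_mk n).continuous.comp h

theorem CP.exists_rep_ne_zero {n : ℕ} (p : CP n) : ∃ i, p.rep i ≠ 0 :=
  Function.ne_iff.1 p.rep_nonzero

instance CP.instChartedSpace (n : ℕ) : ChartedSpace (Fin n → ℂ) (CP n) where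
  atlas := Set.range CP.chart
  chartAt p := CP.chart p.exists_rep_ne_zero.choose
  mem_chart_source p := p.exists_rep_ne_zero.choose_spec
  chart_mem_atlas _ := Set.mem_range_self _

/-- `ℙⁿ` is a complex manifold: the transition maps of the affine charts are holomorphic. -/
instance CP.instIsManifold (n : ℕ) : IsManifold 𝓘(ℂ, Fin n → ℂ) ω (CP n) := by
  refine isManifold_of_contDiffOn _ _ _ ?_
  rintro _ _ ⟨i, rfl⟩ ⟨j, rfl⟩
  have key : ∀ k : Fin (n + 1),
      ContDiff ℂ ω (fun w : Fin n → ℂ => (i.insertNth (1 : ℂ) w : Fin (n + 1) → ℂ) k) := by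
    intro k
    refine Fin.succAboveCases i ?_ (fun k => ?_) k
    · simpa using contDiff_const
    · simpa using contDiff_apply ℂ ℂ k
  have h : ContDiffOn ℂ ω (fun w : Fin n → ℂ => fun k : Fin n =>
      (i.insertNth (1 : ℂ) w : Fin (n + 1) → ℂ) (j.succAbove k) /
        (i.insertNth (1 : ℂ) w : Fin (n + 1) → ℂ) j)
      {w | (i.insertNth (1 : ℂ) w : Fin (n + 1) → ℂ) j ≠ 0} :=
    contDiffOn_pi.2 fun k => (key _).contDiffOn.div (key _).contDiffOn fun w hw => hw
  refine (h.mono ?_).congr ?_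
  · rintro w ⟨⟨-, hw⟩, -⟩
    exact (CP.rep_mk_ne_zero_iff _ (CP.insertNth_ne_zero i w) j).1 hw
  · intro w _
    ext k
    exact CP.rep_mk_div _ (CP.insertNth_ne_zero i w) j _

/-- The hypersurface `{f = 0} ⊆ ℙⁿ` (meaningful for homogeneous `f`), a topological space with the
subspace topology. -/
def projectiveHypersurface {n : ℕ} (f : MvPolynomial (Fin (n + 1)) ℂ) : Set (CP n) :=
  {p | MvPolynomial.eval p.rep f = 0}

/-- Smoothness of `{f = 0} ⊆ ℙⁿ`: at no point do all partial derivatives of `f` vanish. -/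
def IsSmoothHypersurface {n : ℕ} (f : MvPolynomial (Fin (n + 1)) ℂ) : Prop :=
  ∀ z : Fin (n + 1) → ℂ, z ≠ 0 → MvPolynomial.eval z f = 0 →
    ∃ i, MvPolynomial.eval z (MvPolynomial.pderiv i f) ≠ 0

/-! ### Real differential forms on a complex manifold, in charts -/

section Forms

variable (m : ℕ) (M : Type*) [TopologicalSpace M] [ChartedSpace (Fin m → ℂ) M]

/-- Smooth real differential `k`-forms on an `m`-dimensional complex manifold `M`: for every chart
`φ` of the atlas a form on `φ.target ⊆ ℂᵐ`, smooth in the real sense, such that these forms are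
pulled back to each other by the transition maps `ψ ∘ φ⁻¹`. The values outside `φ.target` have no
meaning. -/
def DiffForm (k : ℕ) : Submodule ℝ
    (atlas (Fin m → ℂ) M → (Fin m → ℂ) → (Fin m → ℂ) [⋀^Fin k]→L[ℝ] ℝ) where
  carrier := {α |
    (∀ φ, ContDiffOn ℝ ∞ (α φ) φ.1.target) ∧
    (∀ φ ψ, ∀ x ∈ (φ.1.symm.trans ψ.1).source,
      α φ x = (α ψ (ψ.1 (φ.1.symm x))).compContinuousLinearMap
        (fderiv ℝ (fun y => ψ.1 (φ.1.symm y)) x))}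
  zero_mem' := ⟨fun _ => contDiffOn_const, fun _ _ _ _ => by ext; simp⟩
  add_mem' {α β} hα hβ := ⟨fun φ => (hα.1 φ).add (hβ.1 φ), fun φ ψ x hx => by
    ext v
    simp [hα.2 φ ψ x hx, hβ.2 φ ψ x hx]⟩
  smul_mem' c α hα := ⟨fun φ => (hα.1 φ).const_smul c, fun φ ψ x hx => by
    ext v
    simp [hα.2 φ ψ x hx]⟩

variable {m M}

instance DiffForm.instAddCommGroup {k : ℕ} : AddCommGroup (DiffForm m M k) :=
  Submodule.addCommGroup _

theorem differentiableAt_diffForm {k : ℕ} (α : DiffForm m M k) (φ : atlas (Fin m → ℂ) M)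
    {x : Fin m → ℂ} (hx : x ∈ φ.1.target) : DifferentiableAt ℝ (α.1 φ) x :=
  ((α.2.1 φ).contDiffAt (φ.1.open_target.mem_nhds hx)).differentiableAt (by simp)

variable (m M)

/-- Closed forms: `dα = 0`. -/
def closedForms (k : ℕ) : Submodule ℝ (DiffForm m M k) where
  carrier := {α | ∀ φ, ∀ x ∈ φ.1.target, extDeriv (α.1 φ) x = 0}
  zero_mem' φ x _ := by
    have h := extDeriv_smul (x := x) (0 : ℝ)
      (0 : (Fin m → ℂ) → (Fin m → ℂ) [⋀^Fin k]→L[ℝ] ℝ)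
    simpa using h
  add_mem' {α β} hα hβ φ x hx := by
    have h := extDeriv_add (differentiableAt_diffForm α φ hx) (differentiableAt_diffForm β φ hx)
    rw [hα φ x hx, hβ φ x hx, add_zero] at h
    exact h
  smul_mem' c α hα φ x hx := by
    have h := extDeriv_smul (x := x) c (α.1 φ)
    rw [hα φ x hx, smul_zero] at h
    exact h

/-- Exact `(k+1)`-forms: `α = dη` for a `k`-form `η`. -/
def exactForms (k : ℕ) : Submodule ℝ (DiffForm m M (k + 1)) where
  carrier := {α | ∃ η : DiffForm m M k, ∀ φ, ∀ x ∈ φ.1.target, α.1 φ x = extDeriv (η.1 φ) x}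
  zero_mem' := ⟨0, fun φ x _ => by
    have h := extDeriv_smul (x := x) (0 : ℝ)
      (0 : (Fin m → ℂ) → (Fin m → ℂ) [⋀^Fin k]→L[ℝ] ℝ)
    simpa using h.symm⟩
  add_mem' := by
    rintro α β ⟨η, hη⟩ ⟨θ, hθ⟩
    refine ⟨η + θ, fun φ x hx => ?_⟩
    have h := extDeriv_add (differentiableAt_diffForm η φ hx) (differentiableAt_diffForm θ φ hx)
    rw [← hη φ x hx, ← hθ φ x hx] at h
    exact h.symm
  smul_mem' := by
    rintro c α ⟨η, hη⟩
    refine ⟨c • η, fun φ x hx => ?_⟩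
    have h := extDeriv_smul (x := x) c (η.1 φ)
    rw [← hη φ x hx] at h
    exact h.symm

/-- De Rham cohomology `H²(M; ℝ)`: closed 2-forms modulo exact ones. -/
abbrev DeRhamH2 : Type _ :=
  closedForms m M 2 ⧸ (exactForms m M 1).comap (closedForms m M 2).subtype

variable {m M}

/-- The class in `H²(M; ℝ)` of a closed 2-form. -/
def deRhamClass (α : closedForms m M 2) : DeRhamH2 m M := Submodule.Quotient.mk α

/-- The real 2-form `i∂∂̄u` at `x`, evaluated on `(v, w)`, for a real function `u` on `ℂᵐ`. With
`J` the multiplication by `i`, one has `i∂∂̄u = -½ d(du ∘ J)`, so that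
`i∂∂̄u (v, w) = ½ (D²u(Jv, w) - D²u(v, Jw))`; for `u = |z|²` on `ℂ` this is `i dz ∧ dz̄`. -/
def iddbar (u : (Fin m → ℂ) → ℝ) (x v w : Fin m → ℂ) : ℝ :=
  (1 / 2) * (fderiv ℝ (fderiv ℝ u) x (Complex.I • v) w
    - fderiv ℝ (fderiv ℝ u) x v (Complex.I • w))

end Forms

/-! ### Hermitian and Kähler metrics, the first Chern class, Calabi–Yau manifolds -/

section Metrics

variable (m : ℕ) (M : Type*) [TopologicalSpace M] [ChartedSpace (Fin m → ℂ) M]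

/-- A smooth Hermitian metric on the holomorphic tangent bundle `T_M`: in every chart `φ` a smooth
field `G` of positive definite Hermitian matrices, `⟨v, w⟩ = v̄ᵀ G w`, compatible with the
(complex linear) derivatives of the transition maps. Values outside `φ.target` have no meaning. -/
structure HermitianMetric where
  inChart : atlas (Fin m → ℂ) M → (Fin m → ℂ) → Matrix (Fin m) (Fin m) ℂ
  smooth : ∀ φ i j, ContDiffOn ℝ ∞ (fun x => inChart φ x i j) φ.1.target
  posDef : ∀ φ, ∀ x ∈ φ.1.target, (inChart φ x).PosDef
  compat : ∀ φ ψ, ∀ x ∈ (φ.1.symm.trans ψ.1).source, ∀ v w : Fin m → ℂ,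
    star v ⬝ᵥ (inChart φ x).mulVec w =
      star (fderiv ℂ (fun y => ψ.1 (φ.1.symm y)) x v) ⬝ᵥ
        (inChart ψ (ψ.1 (φ.1.symm x))).mulVec (fderiv ℂ (fun y => ψ.1 (φ.1.symm y)) x w)

variable {m M}

/-- `α` is the fundamental 2-form `α(v, w) = Re ⟨Jv, w⟩ = Im ⟨v, w⟩` of the metric `g`. -/
def HermitianMetric.IsFundamentalForm (g : HermitianMetric m M) (α : DiffForm m M 2) : Prop :=
  ∀ φ, ∀ x ∈ φ.1.target, ∀ v w : Fin m → ℂ,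
    α.1 φ x ![v, w] = (star v ⬝ᵥ (g.inChart φ x).mulVec w).im

/-- `g` is a Kähler metric: its fundamental form is closed. -/
def HermitianMetric.IsKahler (g : HermitianMetric m M) : Prop :=
  ∃ α ∈ closedForms m M 2, g.IsFundamentalForm α

/-- `α` is the first Chern form `(i/2π) tr Θ = -(i/2π) ∂∂̄ log det g` of `(T_M, g)`, where `Θ` is the
curvature of the Chern connection; that is, `1/2π` times the Ricci form. -/
def HermitianMetric.IsFirstChernForm (g : HermitianMetric m M) (α : DiffForm m M 2) : Prop :=
  ∀ φ, ∀ x ∈ φ.1.target, ∀ v w : Fin m → ℂ,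
    α.1 φ x ![v, w] =
      -(1 / (2 * Real.pi)) * iddbar (fun y => Real.log (g.inChart φ y).det.re) x v w

/-- `c₁(T_M) = c` in `H²(M; ℝ)`: the first Chern form of every Hermitian metric on `T_M` is a closed
form with class `c` (Hermitian metrics being required to exist). -/
def IsFirstChernClass (c : DeRhamH2 m M) : Prop :=
  Nonempty (HermitianMetric m M) ∧
  ∀ g : HermitianMetric m M, ∃ α : closedForms m M 2,
    g.IsFirstChernForm α.1 ∧ deRhamClass α = c

variable (m M)

/-- A compact complex manifold of dimension `m`. -/
structure IsCompactComplexManifold : Prop where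
  isManifold : IsManifold 𝓘(ℂ, Fin m → ℂ) ω M
  nonempty : Nonempty M
  compactSpace : CompactSpace M
  t2Space : T2Space M

/-- A Calabi–Yau `m`-fold: a compact complex manifold of dimension `m` that admits a Kähler metric
and has `c₁(T_M) = 0` in `H²(M; ℝ)`. -/
structure IsCalabiYau : Prop where
  isCompactComplexManifold : IsCompactComplexManifold m M
  exists_kahler : ∃ g : HermitianMetric m M, g.IsKahler
  firstChernClass_eq_zero : IsFirstChernClass (0 : DeRhamH2 m M)

variable {m M}

/-- `α` is the pull-back along `ι : M → ℙⁿ` of the Fubini–Study form `(i/2π) ∂∂̄ log |z|²`, which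
represents the hyperplane class `H = c₁(𝒪(1))`. Where `z_j ≠ 0`, it is
`(i/2π) ∂∂̄ log ∑ₖ |z_k / z_j|²`. -/
def IsFubiniStudyForm {n : ℕ} (ι : M → CP n) (α : DiffForm m M 2) : Prop :=
  ∀ φ, ∀ x ∈ φ.1.target, ∀ j, (ι (φ.1.symm x)).rep j ≠ 0 → ∀ v w : Fin m → ℂ,
    α.1 φ x ![v, w] = (1 / (2 * Real.pi)) *
      iddbar (fun y => Real.log (∑ k,
        ‖(ι (φ.1.symm y)).rep k / (ι (φ.1.symm y)).rep j‖ ^ 2)) x v w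

end Metrics

end

/-!
Everything about differential forms on `M` is reduced to holomorphic lifts: each chart `φ` comes
with a holomorphic `σ : φ.target → ℂⁿ⁺¹ ∖ {0}` lifting `φ⁻¹`, whose differential is injective modulo
the line through `σ` (`IsImmersedLift`). Two lifts differ by a nowhere vanishing holomorphic factor
`c`.

* Calculus: `i∂∂̄u = d(-½ du ∘ J)` is closed, commutes with holomorphic pull-back because
  exterior derivatives do, and vanishes on `log |g|²` for `g` holomorphic without zeros.
* Fubini–Study: `i∂∂̄ log |σ|²` is twice the imaginary part of the Hermitian form
  `⟨v, w⟩/|σ|² - ⟨v, σ⟩⟨σ, w⟩/|σ|⁴` evaluated on `dσ`. This form depends only on the line through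
  `σ` and on vectors modulo that line (`fubiniStudy_rescale`), so it is globally defined, and it is
  positive by the Cauchy–Schwarz inequality (`fubiniStudy_pos`).
* Adjunction: on the cone over `M`, the number `R = det (ξ, σ, ∂₁σ, …, ∂_mσ) / df(ξ)` does not
  depend on `ξ`, because `σ` and the `∂_jσ` span the kernel of `df`, by Euler's identity
  (`det_frameMatrix_mul_eq`). It is the inverse of the coefficient of the Poincaré residue,
  holomorphic and without zeros, and under a change of charts with Jacobian matrix `A` it is
  multiplied by `c ^ (m + 2 - d) / det A` (`residueCoeff_transition`). Hence for a Hermitian metric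
  `g` on `T_M` the function `log det g - log |R|² + (m + 2 - d) log |σ|²` is globally defined on
  `M`. Its `i∂∂̄` is exact, and the middle term does not contribute to it, so that
  `-(1/2π) i∂∂̄ log det g` is cohomologous to `m + 2 - d` times the Fubini–Study form.
* Charts: where `z_i ≠ 0`, Euler's identity provides a coordinate `w_k` with `∂f/∂w_k ≠ 0`;
  replacing `w_k` by the affine equation of `M` gives a chart of `ℙⁿ` in which `M` is a coordinate slice
  (`AdaptedChart`). The affine coordinates of a point, with `1` in place `i`, are the lift.
* Topology: `ℙⁿ` is the image of a sphere, and embeds into matrices by `z z*/|z|²`; `M` is closed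
  in it, and non-empty since `ℂ` is algebraically closed.
-/

open scoped ContDiff Manifold Topology ComplexOrder LinearAlgebra.Projectivization

noncomputable section

/-! ### The operator `i∂∂̄` and holomorphic maps -/

section DDbar

variable {E F : Type*} [NormedAddCommGroup E] [NormedSpace ℝ E] [NormedSpace ℂ E]
  [IsScalarTower ℝ ℂ E] [NormedAddCommGroup F] [NormedSpace ℝ F] [NormedSpace ℂ F]
  [IsScalarTower ℝ ℂ F]

theorem two_le_infty : minSmoothness ℝ 2 ≤ (∞ : WithTop ℕ∞) := by
  rw [minSmoothness_of_isRCLikeNormedField]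
  exact WithTop.coe_le_coe.2 le_top

theorem ContDiffAt.eventually_differentiableAt {𝕜 E F : Type*} [NontriviallyNormedField 𝕜]
    [NormedAddCommGroup E] [NormedSpace 𝕜 E] [NormedAddCommGroup F] [NormedSpace 𝕜 F]
    {n : WithTop ℕ∞} {u : E → F} {x : E} (hu : ContDiffAt 𝕜 n u x) (hn : 1 ≤ n) :
    ∀ᶠ y in 𝓝 x, DifferentiableAt 𝕜 u y :=
  ((hu.of_le hn).eventually (by simp)).mono fun _ h => h.differentiableAt (by simp)

/-- Multiplication by `i`, as a real linear map. -/
def mulI (E : Type*) [NormedAddCommGroup E] [NormedSpace ℝ E] [NormedSpace ℂ E]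
    [IsScalarTower ℝ ℂ E] : E →L[ℝ] E :=
  (Complex.I • ContinuousLinearMap.id ℂ E).restrictScalars ℝ

@[simp]
theorem mulI_apply (v : E) : mulI E v = Complex.I • v := rfl

/-- Precomposition with `-½ J`, as a map from covectors to 1-forms. -/
def negHalfCompI (E : Type*) [NormedAddCommGroup E] [NormedSpace ℝ E] [NormedSpace ℂ E]
    [IsScalarTower ℝ ℂ E] : (E →L[ℝ] ℝ) →L[ℝ] (E [⋀^Fin 1]→L[ℝ] ℝ) :=
  ((ContinuousAlternatingMap.ofSubsingletonLIE (𝕜 := ℝ) (E := E) (F := ℝ)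
        (0 : Fin 1)).toContinuousLinearEquiv :
      (E →L[ℝ] ℝ) →L[ℝ] (E [⋀^Fin 1]→L[ℝ] ℝ)).comp
    ((-(1 / 2 : ℝ)) • (ContinuousLinearMap.compL ℝ E E ℝ).flip (mulI E))

theorem negHalfCompI_apply (L : E →L[ℝ] ℝ) (v : Fin 1 → E) :
    negHalfCompI E L v = -(1 / 2) * L (Complex.I • v 0) := by
  simp [negHalfCompI]

/-- The 1-form `-½ du ∘ J`, whose exterior derivative is `i∂∂̄u`. -/
def dcForm (u : E → ℝ) (x : E) : E [⋀^Fin 1]→L[ℝ] ℝ := negHalfCompI E (fderiv ℝ u x)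

/-- The real 2-form `i∂∂̄u = -½ d(du ∘ J)`. -/
def ddbarForm (u : E → ℝ) (x : E) : E [⋀^Fin 2]→L[ℝ] ℝ := extDeriv (dcForm u) x

theorem contDiffAt_dcForm {u : E → ℝ} {x : E} (hu : ContDiffAt ℝ ∞ u x) :
    ContDiffAt ℝ ∞ (dcForm u) x :=
  (negHalfCompI E).contDiff.contDiffAt.comp x (hu.fderiv_right (m := ∞) (by simp))

theorem contDiffAt_ddbarForm {u : E → ℝ} {x : E} (hu : ContDiffAt ℝ ∞ u x) :
    ContDiffAt ℝ ∞ (ddbarForm u) x :=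
  ContDiffAt.comp (g := ContinuousAlternatingMap.alternatizeUncurryFinCLM (n := 1) ℝ E ℝ) x
    (ContinuousLinearMap.contDiff _).contDiffAt
    ((contDiffAt_dcForm hu).fderiv_right (m := ∞) (by simp))

theorem extDeriv_ddbarForm {u : E → ℝ} {x : E} (hu : ContDiffAt ℝ ∞ u x) :
    extDeriv (ddbarForm u) x = 0 :=
  extDeriv_extDeriv_apply (contDiffAt_dcForm hu) two_le_infty

theorem ddbarForm_apply {u : E → ℝ} {x : E} (hu : ContDiffAt ℝ ∞ u x) (v w : E) :
    ddbarForm u x ![v, w] = (1 / 2) * (fderiv ℝ (fderiv ℝ u) x (Complex.I • v) w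
      - fderiv ℝ (fderiv ℝ u) x v (Complex.I • w)) := by
  have hd : DifferentiableAt ℝ (fderiv ℝ u) x :=
    (hu.fderiv_right (m := ∞) (by simp)).differentiableAt (by simp)
  have h1 : fderiv ℝ (dcForm u) x = (negHalfCompI E).comp (fderiv ℝ (fderiv ℝ u) x) :=
    ((negHalfCompI E).hasFDerivAt.comp x hd.hasFDerivAt).fderiv
  have hs : IsSymmSndFDerivAt ℝ u x := hu.isSymmSndFDerivAt two_le_infty
  have hs' := hs w (Complex.I • v)
  rw [ddbarForm, extDeriv, ContinuousAlternatingMap.alternatizeUncurryFin_apply, h1]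
  simp [Fin.sum_univ_two, negHalfCompI_apply, Fin.removeNth, hs']
  ring

theorem dcForm_congr {u v : E → ℝ} {x : E} (h : u =ᶠ[𝓝 x] v) : dcForm u =ᶠ[𝓝 x] dcForm v :=
  (h.fderiv (𝕜 := ℝ)).mono fun y hy => by simp only [dcForm, hy]

theorem ddbarForm_congr {u v : E → ℝ} {x : E} (h : u =ᶠ[𝓝 x] v) : ddbarForm u x = ddbarForm v x :=
  (dcForm_congr h).extDeriv_eq

theorem dcForm_add {u v : E → ℝ} {x : E} (hu : DifferentiableAt ℝ u x)
    (hv : DifferentiableAt ℝ v x) : dcForm (fun y => u y + v y) x = dcForm u x + dcForm v x := by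
  simp only [dcForm]
  rw [fderiv_fun_add hu hv, map_add]

theorem ddbarForm_add {u v : E → ℝ} {x : E} (hu : ContDiffAt ℝ ∞ u x) (hv : ContDiffAt ℝ ∞ v x) :
    ddbarForm (fun y => u y + v y) x = ddbarForm u x + ddbarForm v x := by
  have h : dcForm (fun y => u y + v y) =ᶠ[𝓝 x] dcForm u + dcForm v := by
    filter_upwards [hu.eventually_differentiableAt (by simp),
      hv.eventually_differentiableAt (by simp)] with y h1 h2
    exact dcForm_add h1 h2
  exact h.extDeriv_eq.trans (extDeriv_add ((contDiffAt_dcForm hu).differentiableAt (by simp))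
    ((contDiffAt_dcForm hv).differentiableAt (by simp)))

theorem ddbarForm_const_mul {u : E → ℝ} (c : ℝ) {x : E} (hu : ContDiffAt ℝ ∞ u x) :
    ddbarForm (fun y => c * u y) x = c • ddbarForm u x := by
  have h : dcForm (fun y => c * u y) =ᶠ[𝓝 x] c • dcForm u := by
    filter_upwards [hu.eventually_differentiableAt (by simp)] with y h1
    simp only [dcForm, Pi.smul_apply]
    rw [fderiv_const_mul h1, map_smul]
  exact h.extDeriv_eq.trans (extDeriv_smul c _)

/-- The real derivative of a holomorphic map is its complex derivative. -/
theorem fderiv_real_apply {h : E → F} {x : E} (hh : DifferentiableAt ℂ h x) (v : E) :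
    fderiv ℝ h x v = fderiv ℂ h x v := by
  rw [hh.fderiv_restrictScalars ℝ]; rfl

/-- Holomorphic maps commute with `J`, so that `-½ du ∘ J` pulls back to `-½ d(u ∘ h) ∘ J`. -/
theorem dcForm_comp {u : F → ℝ} {h : E → F} {x : E} (hu : DifferentiableAt ℝ u (h x))
    (hh : DifferentiableAt ℂ h x) :
    dcForm (fun y => u (h y)) x =
      (dcForm u (h x)).compContinuousLinearMap (fderiv ℝ h x) := by
  ext v
  have h1 : fderiv ℝ (fun y => u (h y)) x = (fderiv ℝ u (h x)).comp (fderiv ℝ h x) :=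
    fderiv_comp x hu (hh.restrictScalars ℝ)
  simp [dcForm, negHalfCompI_apply, h1, fderiv_real_apply hh]

/-- `i∂∂̄` commutes with the pull-back along a holomorphic map. -/
theorem ddbarForm_comp {u : F → ℝ} {h : E → F} {x : E} (hu : ContDiffAt ℝ ∞ u (h x))
    (hh : ContDiffAt ℂ ω h x) :
    ddbarForm (fun y => u (h y)) x =
      (ddbarForm u (h x)).compContinuousLinearMap (fderiv ℝ h x) := by
  have hR : ContDiffAt ℝ ω h x := hh.restrict_scalars ℝ
  have e : dcForm (fun y => u (h y)) =ᶠ[𝓝 x]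
      fun y => (dcForm u (h y)).compContinuousLinearMap (fderiv ℝ h y) := by
    filter_upwards [hh.eventually_differentiableAt (by simp),
      hh.continuousAt.eventually (hu.eventually_differentiableAt (by simp))] with y h1 h2
    exact dcForm_comp h2 h1
  exact e.extDeriv_eq.trans
    (extDeriv_pullback ((contDiffAt_dcForm hu).differentiableAt (by simp)) hR (by simp))

end DDbar

theorem iddbar_eq_ddbarForm {m : ℕ} {u : (Fin m → ℂ) → ℝ} {x : Fin m → ℂ}
    (hu : ContDiffAt ℝ ∞ u x) (v w : Fin m → ℂ) : iddbar u x v w = ddbarForm u x ![v, w] :=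
  (ddbarForm_apply hu v w).symm

/-! ### The Fubini–Study form on a complex coordinate space -/

section FubiniStudy

variable {ι : Type*} [Fintype ι]

/-- The square `∑ |z_k|²` of the Hermitian norm. -/
def sumNormSq (z : ι → ℂ) : ℝ := ∑ k, ‖z k‖ ^ 2

/-- The real part of the standard Hermitian inner product, as a real bilinear map. -/
def reDot (ι : Type*) [Fintype ι] : (ι → ℂ) →L[ℝ] (ι → ℂ) →L[ℝ] ℝ :=
  ∑ k, (innerSL ℝ (E := ℂ)).bilinearComp (ContinuousLinearMap.proj k)
    (ContinuousLinearMap.proj k)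

theorem reDot_apply (z w : ι → ℂ) : reDot ι z w = (star z ⬝ᵥ w).re := by
  simp [reDot, dotProduct, Complex.inner, mul_comm]

theorem reDot_comm (z w : ι → ℂ) : reDot ι z w = reDot ι w z := by
  simp only [reDot, sum_apply, ContinuousLinearMap.bilinearComp_apply,
    innerSL_apply_apply]
  exact Finset.sum_congr rfl fun k _ => real_inner_comm _ _

theorem sumNormSq_eq_reDot (z : ι → ℂ) : sumNormSq z = reDot ι z z := by
  simp [reDot, sumNormSq]

theorem star_dotProduct_self (z : ι → ℂ) : star z ⬝ᵥ z = (sumNormSq z : ℂ) := by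
  simp [dotProduct, sumNormSq, Complex.conj_mul']

theorem star_dotProduct_comm (z w : ι → ℂ) : star (star z ⬝ᵥ w) = star w ⬝ᵥ z := by
  rw [← Matrix.star_dotProduct_star, star_star, dotProduct_comm]

theorem sumNormSq_pos {z : ι → ℂ} (hz : z ≠ 0) : 0 < sumNormSq z := by
  obtain ⟨k, hk⟩ := Function.ne_iff.1 hz
  exact Finset.sum_pos' (fun i _ => by positivity)
    ⟨k, Finset.mem_univ k, by have := norm_pos_iff.2 hk; positivity⟩

theorem sumNormSq_smul (c : ℂ) (z : ι → ℂ) : sumNormSq (c • z) = ‖c‖ ^ 2 * sumNormSq z := by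
  simp [sumNormSq, mul_pow, Finset.mul_sum]

theorem hasFDerivAt_sumNormSq (z : ι → ℂ) :
    HasFDerivAt sumNormSq ((2 : ℝ) • reDot ι z) z := by
  have h : HasFDerivAt (fun z => reDot ι z z) _ z :=
    (reDot ι).hasFDerivAt.clm_apply (hasFDerivAt_id z)
  refine (h.congr_of_eventuallyEq (.of_forall sumNormSq_eq_reDot)).congr_fderiv ?_
  ext w
  simp [reDot_comm w z]
  ring

theorem contDiff_sumNormSq : ContDiff ℝ ω (sumNormSq (ι := ι)) := by
  have h : ContDiff ℝ ω fun z : ι → ℂ => reDot ι z z :=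
    (reDot ι).contDiff.clm_apply contDiff_id
  rwa [← funext sumNormSq_eq_reDot] at h

theorem contDiffAt_log_sumNormSq {z : ι → ℂ} (hz : z ≠ 0) :
    ContDiffAt ℝ ω (fun y => Real.log (sumNormSq y)) z :=
  contDiff_sumNormSq.contDiffAt.log (sumNormSq_pos hz).ne'

/-- The second derivative of `log |z|²`. -/
theorem fderiv_fderiv_log_sumNormSq {z : ι → ℂ} (hz : z ≠ 0) (v w : ι → ℂ) :
    fderiv ℝ (fderiv ℝ fun y => Real.log (sumNormSq y)) z v w =
      2 * reDot ι v w / sumNormSq z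
        - 4 * reDot ι z v * reDot ι z w / sumNormSq z ^ 2 := by
  have hN := (sumNormSq_pos hz).ne'
  have h1 : fderiv ℝ (fun y => Real.log (sumNormSq y)) =ᶠ[𝓝 z]
      fun y => (sumNormSq y)⁻¹ • (2 : ℝ) • reDot ι y := by
    filter_upwards [isOpen_ne.mem_nhds hz] with y hy
    exact ((hasFDerivAt_sumNormSq y).log (sumNormSq_pos hy).ne').fderiv
  have h2 : HasFDerivAt (fun y => (sumNormSq y)⁻¹ • (2 : ℝ) • reDot ι y) _ z :=
    ((hasDerivAt_inv hN).comp_hasFDerivAt z (hasFDerivAt_sumNormSq z)).smul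
      ((reDot ι).hasFDerivAt.const_smul (2 : ℝ))
  rw [h1.fderiv_eq, h2.fderiv]
  simp
  field_simp
  ring

/-- The Hermitian form `⟨v, w⟩/|z|² - ⟨v, z⟩⟨z, w⟩/|z|⁴` on `ℂⁿ⁺¹`: up to a constant, the pull-back
of the Fubini–Study metric from `ℙⁿ`, at the point `z ≠ 0`. -/
def fubiniStudy (z v w : ι → ℂ) : ℂ :=
  (star v ⬝ᵥ w) / sumNormSq z - (star v ⬝ᵥ z) * (star z ⬝ᵥ w) / (sumNormSq z : ℂ) ^ 2

/-- On `ℂⁿ⁺¹ ∖ {0}`, the form `i∂∂̄ log |z|²` is twice the imaginary part of `fubiniStudy`. -/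
theorem ddbarForm_log_sumNormSq {z : ι → ℂ} (hz : z ≠ 0) (v w : ι → ℂ) :
    ddbarForm (fun y => Real.log (sumNormSq y)) z ![v, w] = 2 * (fubiniStudy z v w).im := by
  rw [ddbarForm_apply ((contDiffAt_log_sumNormSq hz).of_le (by simp)),
    fderiv_fderiv_log_sumNormSq hz, fderiv_fderiv_log_sumNormSq hz]
  have e : fubiniStudy z v w = ((sumNormSq z)⁻¹ : ℝ) * (star v ⬝ᵥ w)
      - (((sumNormSq z) ^ 2)⁻¹ : ℝ) * (star (star z ⬝ᵥ v) * (star z ⬝ᵥ w)) := by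
    rw [star_dotProduct_comm, fubiniStudy]
    push_cast
    ring
  rw [e, Complex.sub_im, Complex.im_ofReal_mul, Complex.im_ofReal_mul]
  simp only [reDot_apply, star_smul, smul_dotProduct, dotProduct_smul, smul_eq_mul]
  simp
  ring

theorem fubiniStudy_star (z v w : ι → ℂ) : star (fubiniStudy z v w) = fubiniStudy z w v := by
  simp only [fubiniStudy, star_sub, star_div₀, star_mul, star_dotProduct_comm, star_pow]
  simp [mul_comm]

theorem fubiniStudy_smul_right (z v w : ι → ℂ) (c : ℂ) :
    fubiniStudy z v (c • w) = c * fubiniStudy z v w := by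
  simp only [fubiniStudy, dotProduct_smul, smul_eq_mul]
  ring

theorem fubiniStudy_add_right (z v w w' : ι → ℂ) :
    fubiniStudy z v (w + w') = fubiniStudy z v w + fubiniStudy z v w' := by
  simp only [fubiniStudy, dotProduct_add]
  ring

theorem fubiniStudy_smul_left (z v w : ι → ℂ) (c : ℂ) :
    fubiniStudy z (c • v) w = star c * fubiniStudy z v w := by
  rw [← fubiniStudy_star, fubiniStudy_smul_right, star_mul', fubiniStudy_star]

theorem fubiniStudy_add_left (z v v' w : ι → ℂ) :
    fubiniStudy z (v + v') w = fubiniStudy z v w + fubiniStudy z v' w := by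
  rw [← fubiniStudy_star, fubiniStudy_add_right, star_add, fubiniStudy_star, fubiniStudy_star]

theorem fubiniStudy_self_right {z : ι → ℂ} (hz : z ≠ 0) (v : ι → ℂ) : fubiniStudy z v z = 0 := by
  have hN : (sumNormSq z : ℂ) ≠ 0 := by exact_mod_cast (sumNormSq_pos hz).ne'
  rw [fubiniStudy, star_dotProduct_self]
  field_simp
  ring

theorem fubiniStudy_self_left {z : ι → ℂ} (hz : z ≠ 0) (v : ι → ℂ) : fubiniStudy z z v = 0 := by
  rw [← fubiniStudy_star, fubiniStudy_self_right hz, star_zero]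

/-- The Fubini–Study metric depends only on the line through `z`, and on tangent vectors modulo
that line. -/
theorem fubiniStudy_rescale {z : ι → ℂ} (hz : z ≠ 0) {c : ℂ} (hc : c ≠ 0) (a b : ℂ)
    (v w : ι → ℂ) :
    fubiniStudy (c • z) (c • v + a • z) (c • w + b • z) = fubiniStudy z v w := by
  have hN : (sumNormSq z : ℂ) ≠ 0 := by exact_mod_cast (sumNormSq_pos hz).ne'
  have h (v w : ι → ℂ) : fubiniStudy (c • z) v w = (‖c‖ ^ 2 : ℂ)⁻¹ * fubiniStudy z v w := by
    have hc' : (‖c‖ : ℂ) ≠ 0 := by simpa using hc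
    have h2 : star c * c = (‖c‖ : ℂ) ^ 2 := Complex.conj_mul' c
    simp only [fubiniStudy, sumNormSq_smul, star_smul, smul_dotProduct, dotProduct_smul,
      smul_eq_mul]
    push_cast
    field_simp
    linear_combination (- (star v ⬝ᵥ z) * (star z ⬝ᵥ w)) * h2
  have h2 : star c * c = (‖c‖ : ℂ) ^ 2 := Complex.conj_mul' c
  have hc' : (‖c‖ : ℂ) ≠ 0 := by simpa using hc
  simp only [h, fubiniStudy_add_left, fubiniStudy_add_right, fubiniStudy_smul_left,
    fubiniStudy_smul_right, fubiniStudy_self_left hz, fubiniStudy_self_right hz]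
  field_simp
  linear_combination (fubiniStudy z v w) * h2

/-- The Cauchy–Schwarz inequality with its case of equality: `fubiniStudy` is positive on vectors
that are not multiples of `z`. -/
theorem fubiniStudy_pos {z : ι → ℂ} (hz : z ≠ 0) {v : ι → ℂ} (hv : ∀ a : ℂ, v ≠ a • z) :
    0 < fubiniStudy z v v := by
  have hN : (sumNormSq z : ℂ) ≠ 0 := by exact_mod_cast (sumNormSq_pos hz).ne'
  -- replace `v` by its component orthogonal to `z`
  set a : ℂ := (star z ⬝ᵥ v) / sumNormSq z with ha
  set u := v - a • z with hu
  have hu0 : u ≠ 0 := sub_ne_zero.2 (hv a)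
  have hzu : star z ⬝ᵥ u = 0 := by
    rw [hu, dotProduct_sub, dotProduct_smul, star_dotProduct_self, smul_eq_mul, ha]
    field_simp
    ring
  have e : fubiniStudy z v v = fubiniStudy z u u := by
    have : v = u + a • z := by simp [hu]
    rw [this]
    simp [fubiniStudy_add_left, fubiniStudy_add_right, fubiniStudy_smul_left,
      fubiniStudy_smul_right, fubiniStudy_self_left hz, fubiniStudy_self_right hz]
  have e2 : fubiniStudy z u u = ((sumNormSq u / sumNormSq z : ℝ) : ℂ) := by
    rw [fubiniStudy, hzu, star_dotProduct_self]
    simp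
  rw [e, e2]
  exact_mod_cast div_pos (sumNormSq_pos hu0) (sumNormSq_pos hz)

variable {E : Type*} [NormedAddCommGroup E] [NormedSpace ℝ E] [NormedSpace ℂ E]
  [IsScalarTower ℝ ℂ E]

theorem contDiffAt_log_sumNormSq_comp {s : E → ι → ℂ} {x : E} (hs : ContDiffAt ℂ ω s x)
    (h0 : s x ≠ 0) : ContDiffAt ℝ ω (fun y => Real.log (sumNormSq (s y))) x :=
  (contDiffAt_log_sumNormSq h0).comp x (hs.restrict_scalars ℝ)

/-- The form `i∂∂̄ log |s|²` for a nowhere vanishing holomorphic `s`. -/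
theorem ddbarForm_log_sumNormSq_comp {s : E → ι → ℂ} {x : E} (hs : ContDiffAt ℂ ω s x)
    (h0 : s x ≠ 0) (v w : E) :
    ddbarForm (fun y => Real.log (sumNormSq (s y))) x ![v, w] =
      2 * (fubiniStudy (s x) (fderiv ℂ s x v) (fderiv ℂ s x w)).im := by
  rw [ddbarForm_comp (u := fun z => Real.log (sumNormSq z))
    ((contDiffAt_log_sumNormSq h0).of_le (by simp)) hs, ← ddbarForm_log_sumNormSq h0]
  have hd := hs.differentiableAt (by simp)
  simp only [ContinuousAlternatingMap.compContinuousLinearMap_apply]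
  congr 1
  ext i : 1
  fin_cases i <;> simp [fderiv_real_apply hd]

/-- `log |g|²` is pluriharmonic for a nowhere vanishing holomorphic function `g`. -/
theorem ddbarForm_log_norm_sq {g : E → ℂ} {x : E} (hg : ContDiffAt ℂ ω g x) (h0 : g x ≠ 0) :
    ddbarForm (fun y => Real.log (‖g y‖ ^ 2)) x = 0 := by
  have hs : ContDiffAt ℂ ω (fun y => (fun _ : Unit => g y)) x := contDiffAt_pi.2 fun _ => hg
  have hne : (fun _ : Unit => g x) ≠ 0 := fun h => h0 (congrFun h ())
  have e : (fun y => Real.log (‖g y‖ ^ 2)) =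
      fun y => Real.log (sumNormSq (fun _ : Unit => g y)) := by
    ext y; simp [sumNormSq]
  rw [e]
  ext v
  have hv : v = ![v 0, v 1] := by ext i; fin_cases i <;> rfl
  -- a vector in a one-dimensional space is a multiple of any nonzero one
  have key (w : Unit → ℂ) : w = (w () / g x) • (fun _ : Unit => g x) := by
    ext; simp [h0]
  rw [hv, ddbarForm_log_sumNormSq_comp hs hne, key (fderiv ℂ _ x (v 1)), fubiniStudy_smul_right,
    fubiniStudy_self_right hne]
  simp

theorem contDiffAt_log_norm_sq {g : E → ℂ} {x : E} (hg : ContDiffAt ℂ ω g x) (h0 : g x ≠ 0) :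
    ContDiffAt ℝ ω (fun y => Real.log (‖g y‖ ^ 2)) x :=
  ((hg.restrict_scalars ℝ).norm_sq ℝ).log (by simpa using h0)

end FubiniStudy

/-! ### Holomorphic lifts and the restricted Fubini–Study metric -/

section Lifts

variable {m n : ℕ} {M : Type*} [TopologicalSpace M]

/-- `σ` is a holomorphic lift to `ℂⁿ⁺¹ ∖ {0}` of the local parametrization `ι ∘ φ⁻¹` of a subset of
`ℙⁿ`, which is moreover an immersion: no nonzero tangent vector is mapped into the line
through `σ x`. -/
structure IsImmersedLift (ι : M → CP n) (φ : OpenPartialHomeomorph M (Fin m → ℂ))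
    (σ : (Fin m → ℂ) → Fin (n + 1) → ℂ) : Prop where
  contDiffOn : ContDiffOn ℂ ω σ φ.target
  exists_eq_smul : ∀ x ∈ φ.target, ∃ c : ℂ, c ≠ 0 ∧ σ x = c • (ι (φ.symm x)).rep
  immersive : ∀ x ∈ φ.target, ∀ v (a : ℂ), fderiv ℂ σ x v = a • σ x → v = 0

namespace IsImmersedLift

variable {ι : M → CP n} {φ ψ : OpenPartialHomeomorph M (Fin m → ℂ)}
  {σ σ' : (Fin m → ℂ) → Fin (n + 1) → ℂ} {x : Fin m → ℂ}

theorem contDiffAt (h : IsImmersedLift ι φ σ) (hx : x ∈ φ.target) : ContDiffAt ℂ ω σ x :=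
  h.contDiffOn.contDiffAt (φ.open_target.mem_nhds hx)

theorem ne_zero (h : IsImmersedLift ι φ σ) (hx : x ∈ φ.target) : σ x ≠ 0 := by
  obtain ⟨c, hc, e⟩ := h.exists_eq_smul x hx
  rw [e]
  exact smul_ne_zero hc (Projectivization.rep_nonzero _)

/-- Lifts of two charts differ by a nowhere vanishing holomorphic factor. -/
theorem exists_transition (h : IsImmersedLift ι φ σ) (h' : IsImmersedLift ι ψ σ')
    (hx : x ∈ (φ.symm.trans ψ).source)
    (hτ : ContDiffAt ℂ ω (fun y => ψ (φ.symm y)) x) :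
    ∃ c : (Fin m → ℂ) → ℂ, ContDiffAt ℂ ω c x ∧ c x ≠ 0 ∧
      ∀ᶠ y in 𝓝 x, σ' (ψ (φ.symm y)) = c y • σ y := by
  have hmem (y) (hy : y ∈ (φ.symm.trans ψ).source) :
      y ∈ φ.target ∧ ψ (φ.symm y) ∈ ψ.target := by
    simp only [OpenPartialHomeomorph.trans_source, OpenPartialHomeomorph.symm_source,
      Set.mem_inter_iff, Set.mem_preimage] at hy
    exact ⟨hy.1, ψ.map_source hy.2⟩
  have hprop (y) (hy : y ∈ (φ.symm.trans ψ).source) :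
      ∃ c : ℂ, c ≠ 0 ∧ σ' (ψ (φ.symm y)) = c • σ y := by
    obtain ⟨a, ha, e⟩ := h.exists_eq_smul y (hmem y hy).1
    obtain ⟨b, hb, e'⟩ := h'.exists_eq_smul _ (hmem y hy).2
    have hy2 : φ.symm y ∈ ψ.source := by simpa using hy.2
    rw [ψ.left_inv hy2] at e'
    exact ⟨b / a, div_ne_zero hb ha, by rw [e, e', smul_smul, div_mul_cancel₀ _ ha]⟩
  obtain ⟨j, hj⟩ := Function.ne_iff.1 (h.ne_zero (hmem x hx).1)
  have hσ := h.contDiffAt (hmem x hx).1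
  have hσ' : ContDiffAt ℂ ω (fun y => σ' (ψ (φ.symm y))) x :=
    (h'.contDiffAt (hmem x hx).2).comp x hτ
  refine ⟨fun y => σ' (ψ (φ.symm y)) j / σ y j,
    (contDiffAt_pi.1 hσ' j).div (contDiffAt_pi.1 hσ j) hj, ?_, ?_⟩
  · obtain ⟨c, hc, e⟩ := hprop x hx
    simp only [Pi.zero_apply] at hj
    simpa [e, hj] using hc
  · filter_upwards [(φ.symm.trans ψ).open_source.mem_nhds hx,
      (contDiffAt_pi.1 hσ j).continuousAt.eventually_ne hj] with y hy hyj
    obtain ⟨c, hc, e⟩ := hprop y hy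
    simp only [Pi.zero_apply] at hyj
    simp [e, hyj]

/-- The differentials of two lifts agree up to scaling and modulo the tautological line. -/
theorem fderiv_transition (h : IsImmersedLift ι φ σ) (h' : IsImmersedLift ι ψ σ')
    (hx : x ∈ (φ.symm.trans ψ).source)
    (hτ : ContDiffAt ℂ ω (fun y => ψ (φ.symm y)) x) :
    ∃ c : ℂ, c ≠ 0 ∧ σ' (ψ (φ.symm x)) = c • σ x ∧ ∃ b : (Fin m → ℂ) → ℂ, ∀ v,
      fderiv ℂ σ' (ψ (φ.symm x)) (fderiv ℂ (fun y => ψ (φ.symm y)) x v) =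
        c • fderiv ℂ σ x v + b v • σ x := by
  obtain ⟨c, hc, hc0, e⟩ := h.exists_transition h' hx hτ
  simp only [OpenPartialHomeomorph.trans_source, OpenPartialHomeomorph.symm_source,
    Set.mem_inter_iff, Set.mem_preimage] at hx
  refine ⟨c x, hc0, e.self_of_nhds, fun v => fderiv ℂ c x v, fun v => ?_⟩
  have h1 : HasFDerivAt (fun y => σ' (ψ (φ.symm y))) _ x :=
    HasFDerivAt.comp x
      ((h'.contDiffAt (ψ.map_source hx.2)).differentiableAt (by simp)).hasFDerivAt
      (hτ.differentiableAt (by simp)).hasFDerivAt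
  have h2 : HasFDerivAt (fun y => c y • σ y) _ x :=
    (hc.differentiableAt (by simp)).hasFDerivAt.smul
      ((h.contDiffAt hx.1).differentiableAt (by simp)).hasFDerivAt
  have h3 := congrArg (fun L => L v) (h1.unique (h2.congr_of_eventuallyEq e))
  simpa using h3

end IsImmersedLift

theorem contDiffAt_transition [ChartedSpace (Fin m → ℂ) M]
    [IsManifold 𝓘(ℂ, Fin m → ℂ) ω M] (φ ψ : atlas (Fin m → ℂ) M) {x : Fin m → ℂ}
    (hx : x ∈ (φ.1.symm.trans ψ.1).source) :
    ContDiffAt ℂ ω (fun y => ψ.1 (φ.1.symm y)) x := by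
  have h := contMDiffOn_of_mem_contDiffGroupoid
    ((contDiffGroupoid ω 𝓘(ℂ, Fin m → ℂ)).compatible φ.2 ψ.2)
  rw [contMDiffOn_iff_contDiffOn] at h
  exact h.contDiffAt ((φ.1.symm.trans ψ.1).open_source.mem_nhds hx)

variable [ChartedSpace (Fin m → ℂ) M] [IsManifold 𝓘(ℂ, Fin m → ℂ) ω M]
  {ι : M → CP n} {σ : atlas (Fin m → ℂ) M → (Fin m → ℂ) → Fin (n + 1) → ℂ}

/-- The pull-back of the Fubini–Study form by a linear map `L`, evaluated by means of its Gram
matrix on the standard basis. -/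
theorem star_dotProduct_fubiniStudy_mulVec (z : Fin (n + 1) → ℂ)
    (L : (Fin m → ℂ) →L[ℂ] (Fin (n + 1) → ℂ)) (c : ℂ) (v w : Fin m → ℂ) :
    star v ⬝ᵥ (Matrix.of fun a b => c * fubiniStudy z (L (Pi.single a 1))
      (L (Pi.single b 1))).mulVec w = c * fubiniStudy z (L v) (L w) := by
  have hv (v : Fin m → ℂ) : L v = ∑ a, v a • L (Pi.single a 1) := by
    conv_lhs => rw [pi_eq_sum_univ' v, map_sum]
    simp only [map_smul]
  have h1 (s : Finset (Fin m)) (u : Fin (n + 1) → ℂ) :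
      fubiniStudy z u (∑ a ∈ s, w a • L (Pi.single a 1)) =
        ∑ a ∈ s, w a * fubiniStudy z u (L (Pi.single a 1)) := by
    induction s using Finset.cons_induction with
    | empty => simp [fubiniStudy]
    | cons a s ha ih =>
      rw [Finset.sum_cons, Finset.sum_cons, fubiniStudy_add_right, fubiniStudy_smul_right, ih]
  have h2 (s : Finset (Fin m)) (u : Fin (n + 1) → ℂ) :
      fubiniStudy z (∑ a ∈ s, v a • L (Pi.single a 1)) u =
        ∑ a ∈ s, star (v a) * fubiniStudy z (L (Pi.single a 1)) u := by
    induction s using Finset.cons_induction with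
    | empty => simp [fubiniStudy]
    | cons a s ha ih =>
      rw [Finset.sum_cons, Finset.sum_cons, fubiniStudy_add_left, fubiniStudy_smul_left, ih]
  rw [hv v, hv w, h2]
  simp only [h1, dotProduct, Matrix.mulVec, Matrix.of_apply, Finset.mul_sum, Pi.star_apply]
  exact Finset.sum_congr rfl fun a _ => Finset.sum_congr rfl fun b _ => by ring

theorem contDiffAt_fubiniStudy {E : Type*} [NormedAddCommGroup E] [NormedSpace ℝ E]
    {z v w : E → Fin (n + 1) → ℂ} {x : E} (hz : ContDiffAt ℝ ∞ z x) (hv : ContDiffAt ℝ ∞ v x)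
    (hw : ContDiffAt ℝ ∞ w x) (h0 : z x ≠ 0) :
    ContDiffAt ℝ ∞ (fun y => fubiniStudy (z y) (v y) (w y)) x := by
  have hdot {v w : E → Fin (n + 1) → ℂ} (hv : ContDiffAt ℝ ∞ v x) (hw : ContDiffAt ℝ ∞ w x) :
      ContDiffAt ℝ ∞ (fun y => star (v y) ⬝ᵥ w y) x := by
    simp only [dotProduct, Pi.star_apply]
    exact ContDiffAt.sum fun k _ =>
      (Complex.conjCLE.contDiff.contDiffAt.comp x (contDiffAt_pi.1 hv k)).mul
        (contDiffAt_pi.1 hw k)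
  have hN : ContDiffAt ℝ ∞ (fun y => (sumNormSq (z y) : ℂ)) x := by
    simpa only [star_dotProduct_self] using hdot hz hz
  have hN0 : (sumNormSq (z x) : ℂ) ≠ 0 := by exact_mod_cast (sumNormSq_pos h0).ne'
  simp only [fubiniStudy, div_eq_mul_inv]
  exact ((hdot hv hw).mul (hN.inv hN0)).sub (((hdot hv hz).mul (hdot hz hw)).mul
    ((hN.pow 2).inv (pow_ne_zero 2 hN0)))

/-- The Fubini–Study metric, normalized by `1/π` and pulled back to `M` by lifts of the charts. -/
def fubiniStudyMetric (hσ : ∀ φ : atlas (Fin m → ℂ) M, IsImmersedLift ι φ.1 (σ φ)) :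
    HermitianMetric m M where
  inChart φ x := Matrix.of fun a b => ((1 / Real.pi : ℝ) : ℂ) *
    fubiniStudy (σ φ x) (fderiv ℂ (σ φ) x (Pi.single a 1)) (fderiv ℂ (σ φ) x (Pi.single b 1))
  smooth φ a b x hx := by
    have h := (hσ φ).contDiffAt hx
    have h1 (c : Fin m) : ContDiffAt ℝ ∞ (fun y => fderiv ℂ (σ φ) y (Pi.single c 1)) x :=
      (((h.fderiv_right (m := ω) (by simp)).clm_apply contDiffAt_const).restrict_scalars ℝ).of_le
        (by simp)
    exact (contDiffAt_const.mul (contDiffAt_fubiniStudy ((h.restrict_scalars ℝ).of_le (by simp))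
      (h1 a) (h1 b) ((hσ φ).ne_zero hx))).contDiffWithinAt
  posDef φ x hx := by
    refine Matrix.PosDef.of_dotProduct_mulVec_pos ?_ fun v hv => ?_
    · ext a b
      simp only [Matrix.conjTranspose_apply, Matrix.of_apply, star_mul', fubiniStudy_star]
      simp
    · rw [star_dotProduct_fubiniStudy_mulVec]
      refine mul_pos (by exact_mod_cast (by positivity : 0 < 1 / Real.pi))
        (fubiniStudy_pos ((hσ φ).ne_zero hx) fun a ha => hv ((hσ φ).immersive x hx v a ha))
  compat φ ψ x hx v w := by
    obtain ⟨c, hc, e, b, hb⟩ :=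
      (hσ φ).fderiv_transition (hσ ψ) hx (contDiffAt_transition φ ψ hx)
    have hx' : x ∈ φ.1.target := by simpa using hx.1
    rw [star_dotProduct_fubiniStudy_mulVec, star_dotProduct_fubiniStudy_mulVec, hb, hb, e,
      fubiniStudy_rescale ((hσ φ).ne_zero hx') hc]

/-- The 2-form `(1/2π) i∂∂̄ log |σ|²` in the chart `φ` is the fundamental form of the Fubini–Study
metric. -/
theorem ddbarForm_eq_im_fubiniStudyMetric
    (hσ : ∀ φ : atlas (Fin m → ℂ) M, IsImmersedLift ι φ.1 (σ φ)) (φ : atlas (Fin m → ℂ) M)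
    {x : Fin m → ℂ} (hx : x ∈ φ.1.target) (v w : Fin m → ℂ) :
    ((1 / (2 * Real.pi)) • ddbarForm (fun y => Real.log (sumNormSq (σ φ y))) x) ![v, w] =
      (star v ⬝ᵥ ((fubiniStudyMetric hσ).inChart φ x).mulVec w).im := by
  rw [ContinuousAlternatingMap.smul_apply,
    ddbarForm_log_sumNormSq_comp ((hσ φ).contDiffAt hx) ((hσ φ).ne_zero hx)]
  simp only [fubiniStudyMetric]
  rw [star_dotProduct_fubiniStudy_mulVec, Complex.im_ofReal_mul, smul_eq_mul]
  field_simp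

theorem vec2_eta {α : Type*} (v : Fin 2 → α) : v = ![v 0, v 1] := by
  ext i; fin_cases i <;> rfl

/-- The restriction to `M` of the Fubini–Study form. -/
def fubiniStudyForm (hσ : ∀ φ : atlas (Fin m → ℂ) M, IsImmersedLift ι φ.1 (σ φ)) :
    closedForms m M 2 :=
  ⟨⟨fun φ x => (1 / (2 * Real.pi)) • ddbarForm (fun y => Real.log (sumNormSq (σ φ y))) x, by
      refine ⟨fun φ x hx => ?_, fun φ ψ x hx => ?_⟩
      · exact ((contDiffAt_ddbarForm ((contDiffAt_log_sumNormSq_comp ((hσ φ).contDiffAt hx)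
          ((hσ φ).ne_zero hx)).of_le (by simp))).const_smul _).contDiffWithinAt
      · have hx' := hx
        simp only [OpenPartialHomeomorph.trans_source, OpenPartialHomeomorph.symm_source,
          Set.mem_inter_iff, Set.mem_preimage] at hx'
        have hτ := (contDiffAt_transition φ ψ hx).differentiableAt (by simp)
        ext v
        rw [vec2_eta v, ddbarForm_eq_im_fubiniStudyMetric hσ φ hx'.1,
          (fubiniStudyMetric hσ).compat φ ψ x hx,
          ← ddbarForm_eq_im_fubiniStudyMetric hσ ψ (ψ.1.map_source hx'.2),
          ContinuousAlternatingMap.compContinuousLinearMap_apply]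
        congr 1
        ext i : 1
        fin_cases i <;> simp [fderiv_real_apply hτ]⟩,
    fun φ x hx => by
      refine (extDeriv_smul _ _).trans ?_
      rw [extDeriv_ddbarForm ((contDiffAt_log_sumNormSq_comp ((hσ φ).contDiffAt hx)
          ((hσ φ).ne_zero hx)).of_le (by simp)), smul_zero]⟩

theorem isFundamentalForm_fubiniStudyForm
    (hσ : ∀ φ : atlas (Fin m → ℂ) M, IsImmersedLift ι φ.1 (σ φ)) :
    (fubiniStudyMetric hσ).IsFundamentalForm (fubiniStudyForm hσ).1 :=
  fun φ _ hx v w => ddbarForm_eq_im_fubiniStudyMetric hσ φ hx v w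

theorem isFubiniStudyForm_fubiniStudyForm
    (hσ : ∀ φ : atlas (Fin m → ℂ) M, IsImmersedLift ι φ.1 (σ φ)) :
    IsFubiniStudyForm ι (fubiniStudyForm hσ).1 := by
  intro φ x hx j hj v w
  have hs := (hσ φ).contDiffAt hx
  have h0 := (hσ φ).ne_zero hx
  have hj' : σ φ x j ≠ 0 := by
    obtain ⟨c, hc, e⟩ := (hσ φ).exists_eq_smul x hx
    simp [e, hc, hj]
  have hsj : ContDiffAt ℂ ω (fun y => σ φ y j) x := contDiffAt_pi.1 hs j
  have h1 : ContDiffAt ℝ ∞ (fun y => Real.log (sumNormSq (σ φ y))) x :=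
    (contDiffAt_log_sumNormSq_comp hs h0).of_le (by simp)
  have h2 : ContDiffAt ℝ ∞ (fun y => Real.log (‖σ φ y j‖ ^ 2)) x :=
    (contDiffAt_log_norm_sq hsj hj').of_le (by simp)
  -- the two potentials differ by the logarithm of the absolute value of a holomorphic function
  have e : (fun y => Real.log (∑ k,
        ‖(ι (φ.1.symm y)).rep k / (ι (φ.1.symm y)).rep j‖ ^ 2)) =ᶠ[𝓝 x]
      fun y => Real.log (sumNormSq (σ φ y)) + (-1) * Real.log (‖σ φ y j‖ ^ 2) := by
    filter_upwards [φ.1.open_target.mem_nhds hx, hsj.continuousAt.eventually_ne hj'] with y hy hyj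
    obtain ⟨c, hc, e⟩ := (hσ φ).exists_eq_smul y hy
    have e1 : ∑ k, ‖(ι (φ.1.symm y)).rep k / (ι (φ.1.symm y)).rep j‖ ^ 2 =
        sumNormSq (σ φ y) / ‖σ φ y j‖ ^ 2 := by
      rw [sumNormSq, Finset.sum_div]
      refine Finset.sum_congr rfl fun k _ => ?_
      rw [← div_pow, ← norm_div, e, Pi.smul_apply, Pi.smul_apply, smul_eq_mul, smul_eq_mul,
        mul_div_mul_left _ _ hc]
    rw [e1, Real.log_div (sumNormSq_pos ((hσ φ).ne_zero hy)).ne' (by simpa using hyj)]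
    ring
  have h3 := (h1.add (contDiffAt_const (c := (-1 : ℝ)) |>.mul h2)).congr_of_eventuallyEq e
  rw [iddbar_eq_ddbarForm h3, ddbarForm_congr e, ddbarForm_add h1 (contDiffAt_const.mul h2),
    ddbarForm_const_mul _ h2, ddbarForm_log_norm_sq hsj hj', smul_zero, add_zero]
  rfl

end Lifts

/-! ### Gradients of polynomials -/

section Gradient

variable {N : ℕ}

/-- The vector of partial derivatives of a polynomial at a point. -/
def polyGrad (f : MvPolynomial (Fin N) ℂ) (z : Fin N → ℂ) : Fin N → ℂ :=
  fun i => MvPolynomial.eval z (MvPolynomial.pderiv i f)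

theorem contDiff_eval (f : MvPolynomial (Fin N) ℂ) :
    ContDiff ℂ ω (fun z => MvPolynomial.eval z f) := by
  induction f using MvPolynomial.induction_on with
  | C a => simpa using contDiff_const
  | add p q hp hq => simpa using hp.add hq
  | mul_X p i hp => simpa using hp.mul (contDiff_apply ℂ ℂ i)

theorem contDiff_polyGrad (f : MvPolynomial (Fin N) ℂ) : ContDiff ℂ ω (polyGrad f) :=
  contDiff_pi.2 fun _ => contDiff_eval _

theorem fderiv_eval (f : MvPolynomial (Fin N) ℂ) (z v : Fin N → ℂ) :
    fderiv ℂ (fun z => MvPolynomial.eval z f) z v = polyGrad f z ⬝ᵥ v := by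
  induction f using MvPolynomial.induction_on with
  | C a => simp [polyGrad, dotProduct]
  | add p q hp hq =>
    have e : (fun z => MvPolynomial.eval z (p + q)) =
        fun z => MvPolynomial.eval z p + MvPolynomial.eval z q := by ext; simp
    have d (p : MvPolynomial (Fin N) ℂ) := (contDiff_eval p).contDiffAt (x := z)
      |>.differentiableAt (by simp)
    rw [e, fderiv_fun_add (d p) (d q), add_apply, hp, hq]
    simp [polyGrad, dotProduct, add_mul, Finset.sum_add_distrib]
  | mul_X p i hp =>
    have e : (fun z => MvPolynomial.eval z (p * MvPolynomial.X i)) =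
        fun z => MvPolynomial.eval z p * z i := by ext; simp
    have d := (contDiff_eval p).contDiffAt (x := z) |>.differentiableAt (by simp)
    have h : HasFDerivAt (𝕜 := ℂ) (fun z : Fin N → ℂ => z i)
        (ContinuousLinearMap.proj (R := ℂ) (φ := fun _ => ℂ) i) z := hasFDerivAt_apply i z
    have h2 : HasFDerivAt (fun z : Fin N → ℂ => MvPolynomial.eval z p * z i) _ z :=
      d.hasFDerivAt.mul h
    rw [e, h2.fderiv]
    simp [hp, polyGrad, dotProduct, add_mul, Finset.sum_add_distrib, Finset.mul_sum,
      MvPolynomial.pderiv_X, Pi.single_apply, apply_ite, mul_assoc]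

variable {f : MvPolynomial (Fin N) ℂ} {d : ℕ}

theorem eval_smul_of_isHomogeneous (hf : f.IsHomogeneous d) (c : ℂ) (z : Fin N → ℂ) :
    MvPolynomial.eval (c • z) f = c ^ d * MvPolynomial.eval z f := by
  rw [MvPolynomial.eval_eq', MvPolynomial.eval_eq', Finset.mul_sum]
  refine Finset.sum_congr rfl fun k hk => ?_
  have h : ∑ i, k i = d := by
    rw [← hf (MvPolynomial.mem_support_iff.1 hk), Finsupp.weight_apply,
      Finsupp.sum_fintype _ _ (by simp)]
    simp
  simp only [Pi.smul_apply, smul_eq_mul, mul_pow, Finset.prod_mul_distrib,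
    Finset.prod_pow_eq_pow_sum, h]
  ring

theorem polyGrad_smul (hf : f.IsHomogeneous d) (c : ℂ) (z : Fin N → ℂ) :
    polyGrad f (c • z) = c ^ (d - 1) • polyGrad f z := by
  ext i
  exact eval_smul_of_isHomogeneous hf.pderiv c z

/-- Euler's identity. -/
theorem polyGrad_dotProduct_self (hf : f.IsHomogeneous d) (z : Fin N → ℂ) :
    polyGrad f z ⬝ᵥ z = d * MvPolynomial.eval z f := by
  have h := congrArg (MvPolynomial.eval z) hf.sum_X_mul_pderiv
  simpa [polyGrad, dotProduct, mul_comm] using h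

end Gradient

/-! ### Frames along the cone over a hypersurface -/

section Frame

variable {m : ℕ}

/-- Splitting off two of `m + 2` indices. -/
def frameEquiv (m : ℕ) : Fin 2 ⊕ Fin m ≃ Fin (m + 1 + 1) :=
  finSumFinEquiv.trans (finCongr (by omega))

/-- The square matrix with rows `ξ`, `s`, `t₁, …, t_m`. -/
def frameMatrix (ξ s : Fin (m + 1 + 1) → ℂ) (t : Fin m → Fin (m + 1 + 1) → ℂ) :
    Matrix (Fin 2 ⊕ Fin m) (Fin 2 ⊕ Fin m) ℂ :=
  Matrix.of fun r c => (Sum.elim ![ξ, s] t r) (frameEquiv m c)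

theorem frameMatrix_mulVec (ξ s : Fin (m + 1 + 1) → ℂ) (t : Fin m → Fin (m + 1 + 1) → ℂ)
    (g : Fin (m + 1 + 1) → ℂ) :
    (frameMatrix ξ s t).mulVec (g ∘ frameEquiv m) =
      fun r => g ⬝ᵥ (Sum.elim ![ξ, s] t r) := by
  ext r
  simp only [frameMatrix, Matrix.mulVec, dotProduct, Matrix.of_apply, Function.comp]
  rw [(frameEquiv m).sum_comp (fun c => Sum.elim ![ξ, s] t r c * g c)]
  simp [mul_comm]

theorem frameMatrix_eq_updateRow (ξ η s : Fin (m + 1 + 1) → ℂ)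
    (t : Fin m → Fin (m + 1 + 1) → ℂ) :
    frameMatrix ξ s t = (frameMatrix η s t).updateRow (Sum.inl 0) (ξ ∘ frameEquiv m) := by
  ext r c
  rcases r with r | r
  · fin_cases r <;> simp [frameMatrix, Matrix.updateRow_apply]
  · simp [frameMatrix, Matrix.updateRow_apply]

/-- If `s, t₁, …, t_m` lie in the hyperplane `g = 0`, then `det (ξ, s, t) / g(ξ)` does not depend
on `ξ`. -/
theorem det_frameMatrix_mul_eq {g s : Fin (m + 1 + 1) → ℂ} {t : Fin m → Fin (m + 1 + 1) → ℂ}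
    (hg : g ≠ 0) (hs : g ⬝ᵥ s = 0) (ht : ∀ j, g ⬝ᵥ t j = 0) (ξ η : Fin (m + 1 + 1) → ℂ) :
    (g ⬝ᵥ η) * (frameMatrix ξ s t).det = (g ⬝ᵥ ξ) * (frameMatrix η s t).det := by
  set ζ := (g ⬝ᵥ η) • ξ + (-(g ⬝ᵥ ξ)) • η with hζ
  -- all rows of the frame of `ζ` lie in the hyperplane, so its determinant vanishes
  have h0 : (frameMatrix ζ s t).det = 0 := by
    refine Matrix.exists_mulVec_eq_zero_iff.1 ⟨g ∘ frameEquiv m, fun h => hg ?_, ?_⟩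
    · ext c
      simpa using congrFun h ((frameEquiv m).symm c)
    · rw [frameMatrix_mulVec]
      ext r
      rcases r with r | r
      · fin_cases r
        · simp [hζ, dotProduct_add, dotProduct_smul, mul_comm]
        · simpa using hs
      · simpa using ht r
  have h1 : (frameMatrix ζ s t).det = (g ⬝ᵥ η) * (frameMatrix ξ s t).det
      + (-(g ⬝ᵥ ξ)) * (frameMatrix η s t).det := by
    have e : ζ ∘ frameEquiv m = (g ⬝ᵥ η) • (ξ ∘ frameEquiv m)
        + (-(g ⬝ᵥ ξ)) • (η ∘ frameEquiv m) := rfl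
    rw [frameMatrix_eq_updateRow ζ ξ, e, Matrix.det_updateRow_add, Matrix.det_updateRow_smul,
      Matrix.det_updateRow_smul, ← frameMatrix_eq_updateRow, ← frameMatrix_eq_updateRow]
  rw [h0] at h1
  linear_combination -h1

/-- The determinant of a frame does not vanish if `ξ` is transverse to the hyperplane `g = 0`, in
which the `t_j` are independent modulo `s`. -/
theorem det_frameMatrix_ne_zero {g ξ s : Fin (m + 1 + 1) → ℂ} {t : Fin m → Fin (m + 1 + 1) → ℂ}
    (hξ : g ⬝ᵥ ξ ≠ 0) (hs : g ⬝ᵥ s = 0) (ht : ∀ j, g ⬝ᵥ t j = 0) (hs0 : s ≠ 0)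
    (hind : ∀ (v : Fin m → ℂ) (a : ℂ), ∑ j, v j • t j = a • s → v = 0) :
    (frameMatrix ξ s t).det ≠ 0 := by
  intro h
  obtain ⟨u, hu0, hu⟩ := Matrix.exists_vecMul_eq_zero_iff.2 h
  have hu' : u (Sum.inl 0) • ξ + u (Sum.inl 1) • s + ∑ j, u (Sum.inr j) • t j = 0 := by
    ext c
    have := congrFun hu ((frameEquiv m).symm c)
    simpa [Matrix.vecMul, dotProduct, frameMatrix, Fintype.sum_sum_type, Fin.sum_univ_two]
      using this
  have h0 : u (Sum.inl 0) = 0 := by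
    have := congrArg (fun y => g ⬝ᵥ y) hu'
    simpa [dotProduct_add, dotProduct_smul, dotProduct_sum, hs, ht, hξ] using this
  rw [h0, zero_smul, zero_add] at hu'
  have h2 := hind (fun j => u (Sum.inr j)) (-u (Sum.inl 1)) (by
    rw [neg_smul]; exact eq_neg_of_add_eq_zero_right hu')
  have h1 : u (Sum.inl 1) = 0 := by
    have h3 (j : Fin m) : u (Sum.inr j) = 0 := congrFun h2 j
    simpa [h3, hs0] using hu'
  apply hu0
  ext r
  rcases r with r | r
  · fin_cases r
    · exact h0
    · exact h1
  · exact congrFun h2 r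

/-- The determinant of a frame under a change of coordinates with Jacobian matrix `A`, combined
with a rescaling of `s` by the function `c` with differential `b`. -/
theorem det_frameMatrix_transition {ξ s : Fin (m + 1 + 1) → ℂ}
    {t t' : Fin m → Fin (m + 1 + 1) → ℂ} {c : ℂ} {b : Fin m → ℂ} {A : Matrix (Fin m) (Fin m) ℂ}
    (h : ∀ j, ∑ l, A l j • t' l = c • t j + b j • s) :
    A.det * (frameMatrix ξ (c • s) t').det = c ^ (m + 1) * (frameMatrix ξ s t).det := by
  set B : Matrix (Fin m) (Fin 2) ℂ := Matrix.of fun j => ![0, b j] with hB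
  have e : Matrix.fromBlocks (1 : Matrix (Fin 2) (Fin 2) ℂ) 0 0 A.transpose *
        frameMatrix ξ (c • s) t' =
      Matrix.fromBlocks (Matrix.diagonal ![1, c]) 0 B (c • (1 : Matrix (Fin m) (Fin m) ℂ)) *
        frameMatrix ξ s t := by
    ext r k
    rcases r with r | r
    · fin_cases r <;>
        simp [Matrix.mul_apply, frameMatrix, Fintype.sum_sum_type, Fin.sum_univ_two,
          Matrix.one_apply]
    · have h1 := congrFun (h r) (frameEquiv m k)
      simp only [Finset.sum_apply, Pi.smul_apply, Pi.add_apply, smul_eq_mul] at h1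
      simp [Matrix.mul_apply, frameMatrix, Fintype.sum_sum_type, Fin.sum_univ_two,
        Matrix.one_apply, h1, hB]
      ring
  have e2 := congrArg Matrix.det e
  rw [Matrix.det_mul, Matrix.det_mul, Matrix.det_fromBlocks_zero₁₂, Matrix.det_fromBlocks_zero₁₂,
    Matrix.det_one, Matrix.det_transpose, Matrix.det_diagonal, Matrix.det_smul, Matrix.det_one]
    at e2
  simp only [one_mul, Fin.prod_univ_two, Fintype.card_fin, mul_one] at e2
  simp only [Matrix.cons_val_zero, Matrix.cons_val_one, one_mul] at e2
  rw [e2, pow_succ']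

end Frame

/-! ### The Poincaré residue and the first Chern class of a hypersurface -/

section Adjunction

variable {m d : ℕ} {M : Type*} [TopologicalSpace M] {ι : M → CP (m + 1)}
  {f : MvPolynomial (Fin (m + 1 + 1)) ℂ} {φ ψ : OpenPartialHomeomorph M (Fin m → ℂ)}
  {σ σ' : (Fin m → ℂ) → Fin (m + 1 + 1) → ℂ} {x : Fin m → ℂ}

/-- The coordinate tangent vectors `∂σ/∂x_j`. -/
def tangentFrame (σ : (Fin m → ℂ) → Fin (m + 1 + 1) → ℂ) (x : Fin m → ℂ) (j : Fin m) :
    Fin (m + 1 + 1) → ℂ :=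
  fderiv ℂ σ x (Pi.single j 1)

theorem sum_smul_tangentFrame (σ : (Fin m → ℂ) → Fin (m + 1 + 1) → ℂ) (x v : Fin m → ℂ) :
    ∑ j, v j • tangentFrame σ x j = fderiv ℂ σ x v := by
  conv_rhs => rw [pi_eq_sum_univ' v, map_sum]
  simp only [map_smul, tangentFrame]

/-- The inverse coefficient of the Poincaré residue of `f` with respect to the coordinates `x`: the
number `det (ξ, σ, ∂₁σ, …, ∂_mσ) / df(ξ)`, which does not depend on `ξ`. Taking for `ξ` the
conjugate of the gradient of `f` makes the denominator `|∇f|²`. -/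
def residueCoeff (f : MvPolynomial (Fin (m + 1 + 1)) ℂ) (σ : (Fin m → ℂ) → Fin (m + 1 + 1) → ℂ)
    (x : Fin m → ℂ) : ℂ :=
  (frameMatrix (star (polyGrad f (σ x))) (σ x) (tangentFrame σ x)).det /
    (polyGrad f (σ x) ⬝ᵥ star (polyGrad f (σ x)))

theorem dotProduct_star_self_ne_zero {n : ℕ} {g : Fin n → ℂ} (hg : g ≠ 0) : g ⬝ᵥ star g ≠ 0 := by
  rw [dotProduct_comm, star_dotProduct_self]
  exact_mod_cast (sumNormSq_pos hg).ne'

namespace IsImmersedLift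

variable (h : IsImmersedLift ι φ σ) (hf : f.IsHomogeneous d) (hsmooth : IsSmoothHypersurface f)
  (hι : ∀ p, MvPolynomial.eval (ι p).rep f = 0)

include h hf hι

theorem eval_eq_zero (hx : x ∈ φ.target) : MvPolynomial.eval (σ x) f = 0 := by
  obtain ⟨c, -, e⟩ := h.exists_eq_smul x hx
  rw [e, eval_smul_of_isHomogeneous hf, hι, mul_zero]

theorem polyGrad_dotProduct (hx : x ∈ φ.target) : polyGrad f (σ x) ⬝ᵥ σ x = 0 := by
  rw [polyGrad_dotProduct_self hf, h.eval_eq_zero hf hι hx, mul_zero]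

theorem polyGrad_dotProduct_fderiv (hx : x ∈ φ.target) (v : Fin m → ℂ) :
    polyGrad f (σ x) ⬝ᵥ fderiv ℂ σ x v = 0 := by
  have e : (fun y => MvPolynomial.eval (σ y) f) =ᶠ[𝓝 x] fun _ => 0 := by
    filter_upwards [φ.open_target.mem_nhds hx] with y hy using h.eval_eq_zero hf hι hy
  have h1 : fderiv ℂ (fun y => MvPolynomial.eval (σ y) f) x =
      (fderiv ℂ (fun z => MvPolynomial.eval z f) (σ x)).comp (fderiv ℂ σ x) :=
    fderiv_comp x ((contDiff_eval f).contDiffAt.differentiableAt (by simp))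
      ((h.contDiffAt hx).differentiableAt (by simp))
  rw [← fderiv_eval, ← ContinuousLinearMap.comp_apply, ← h1, e.fderiv_eq]
  simp

include hsmooth

theorem polyGrad_ne_zero (hx : x ∈ φ.target) : polyGrad f (σ x) ≠ 0 := by
  obtain ⟨i, hi⟩ := hsmooth _ (h.ne_zero hx) (h.eval_eq_zero hf hι hx)
  exact fun h0 => hi (congrFun h0 i)

theorem residueCoeff_mul (hx : x ∈ φ.target) (ξ : Fin (m + 1 + 1) → ℂ) :
    residueCoeff f σ x * (polyGrad f (σ x) ⬝ᵥ ξ) =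
      (frameMatrix ξ (σ x) (tangentFrame σ x)).det := by
  have hg := h.polyGrad_ne_zero hf hsmooth hι hx
  have hg' := dotProduct_star_self_ne_zero hg
  have := det_frameMatrix_mul_eq hg (h.polyGrad_dotProduct hf hι hx)
    (fun j => h.polyGrad_dotProduct_fderiv hf hι hx (Pi.single j 1)) ξ (star (polyGrad f (σ x)))
  rw [residueCoeff, div_mul_eq_mul_div, div_eq_iff hg']
  change _ = Matrix.det (frameMatrix ξ (σ x) fun j => fderiv ℂ σ x (Pi.single j 1)) * _
  rw [mul_comm _ (_ ⬝ᵥ star _), this, mul_comm]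
  rfl

theorem residueCoeff_ne_zero (hx : x ∈ φ.target) : residueCoeff f σ x ≠ 0 := by
  have hg' := dotProduct_star_self_ne_zero (h.polyGrad_ne_zero hf hsmooth hι hx)
  refine div_ne_zero (det_frameMatrix_ne_zero hg' (h.polyGrad_dotProduct hf hι hx)
    (fun j => h.polyGrad_dotProduct_fderiv hf hι hx (Pi.single j 1)) (h.ne_zero hx)
    fun v a e => ?_) hg'
  rw [sum_smul_tangentFrame] at e
  exact h.immersive x hx v a e

/-- The residue coefficient is holomorphic, being locally `det (ξ, σ, ∂σ) / df(ξ)` for a fixed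
`ξ`. -/
theorem contDiffAt_residueCoeff (hx : x ∈ φ.target) : ContDiffAt ℂ ω (residueCoeff f σ) x := by
  set ξ := star (polyGrad f (σ x)) with hξ
  have hg' : polyGrad f (σ x) ⬝ᵥ ξ ≠ 0 :=
    dotProduct_star_self_ne_zero (h.polyGrad_ne_zero hf hsmooth hι hx)
  have hσ := h.contDiffAt hx
  have h1 : ContDiffAt ℂ ω (fun y => polyGrad f (σ y) ⬝ᵥ ξ) x := by
    simp only [dotProduct]
    exact ContDiffAt.sum fun k _ =>
      (contDiffAt_pi.1 ((contDiff_polyGrad f).contDiffAt.comp x hσ) k).mul contDiffAt_const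
  have h2 (j : Fin m) : ContDiffAt ℂ ω (fun y => tangentFrame σ y j) x :=
    (hσ.fderiv_right (m := ω) (by simp)).clm_apply contDiffAt_const
  have h3 : ContDiffAt ℂ ω (fun y => (frameMatrix ξ (σ y) (tangentFrame σ y)).det) x := by
    simp only [Matrix.det_apply']
    refine ContDiffAt.sum fun τ _ => contDiffAt_const.mul (contDiffAt_prod fun k _ => ?_)
    simp only [frameMatrix, Matrix.of_apply]
    rcases τ k with r | r
    · fin_cases r
      · exact contDiffAt_const
      · exact contDiffAt_pi.1 hσ _
    · exact contDiffAt_pi.1 (h2 r) _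
  refine (h3.div h1 hg').congr_of_eventuallyEq ?_
  filter_upwards [φ.open_target.mem_nhds hx, h1.continuousAt.eventually_ne hg'] with y hy hy'
  rw [Pi.div_apply, ← h.residueCoeff_mul hf hsmooth hι hy, mul_div_cancel_right₀ _ hy']

/-- Transformation of the residue coefficient: under a change of coordinates with Jacobian matrix
`A` and a rescaling of the lift by `c` it is multiplied by `c ^ (m + 2 - d) / det A`. -/
theorem residueCoeff_transition (h' : IsImmersedLift ι ψ σ')
    (hx : x ∈ (φ.symm.trans ψ).source) {c : ℂ} (e : σ' (ψ (φ.symm x)) = c • σ x)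
    {b : (Fin m → ℂ) → ℂ}
    (hb : ∀ v, fderiv ℂ σ' (ψ (φ.symm x)) (fderiv ℂ (fun y => ψ (φ.symm y)) x v) =
        c • fderiv ℂ σ x v + b v • σ x) :
    (LinearMap.toMatrix' (fderiv ℂ (fun y => ψ (φ.symm y)) x : (Fin m → ℂ) →ₗ[ℂ] _)).det *
        residueCoeff f σ' (ψ (φ.symm x)) * c ^ (d - 1) = c ^ (m + 1) * residueCoeff f σ x := by
  simp only [OpenPartialHomeomorph.trans_source, OpenPartialHomeomorph.symm_source,
    Set.mem_inter_iff, Set.mem_preimage] at hx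
  set ξ := star (polyGrad f (σ x)) with hξ
  have hg' : polyGrad f (σ x) ⬝ᵥ ξ ≠ 0 :=
    dotProduct_star_self_ne_zero (h.polyGrad_ne_zero hf hsmooth hι hx.1)
  have h1 := h.residueCoeff_mul hf hsmooth hι hx.1 ξ
  have h2 := h'.residueCoeff_mul hf hsmooth hι (ψ.map_source hx.2) ξ
  rw [e, polyGrad_smul hf, smul_dotProduct, smul_eq_mul] at h2
  have h3 := det_frameMatrix_transition (ξ := ξ) (s := σ x) (t := tangentFrame σ x)
    (t' := tangentFrame σ' (ψ (φ.symm x))) (c := c) (b := fun j => b (Pi.single j 1))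
    (A := LinearMap.toMatrix' (fderiv ℂ (fun y => ψ (φ.symm y)) x : (Fin m → ℂ) →ₗ[ℂ] _))
    (fun j => by
      rw [tangentFrame, ← hb, ← sum_smul_tangentFrame]
      simp [LinearMap.toMatrix'_apply])
  rw [← h1, ← h2] at h3
  refine mul_right_cancel₀ hg' ?_
  linear_combination h3

end IsImmersedLift

end Adjunction

section ChernClass

variable {m d : ℕ} {M : Type*} [TopologicalSpace M] [ChartedSpace (Fin m → ℂ) M]

theorem HermitianMetric.det_pos (g : HermitianMetric m M) (φ : atlas (Fin m → ℂ) M)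
    {x : Fin m → ℂ} (hx : x ∈ φ.1.target) : 0 < (g.inChart φ x).det.re :=
  (Complex.pos_iff.1 (g.posDef φ x hx).det_pos).1

theorem HermitianMetric.contDiffAt_log_det (g : HermitianMetric m M) (φ : atlas (Fin m → ℂ) M)
    {x : Fin m → ℂ} (hx : x ∈ φ.1.target) :
    ContDiffAt ℝ ∞ (fun y => Real.log (g.inChart φ y).det.re) x := by
  refine ContDiffAt.log ?_ (g.det_pos φ hx).ne'
  have h : ContDiffAt ℝ ∞ (fun y => (g.inChart φ y).det) x := by
    simp only [Matrix.det_apply']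
    exact ContDiffAt.sum fun τ _ => contDiffAt_const.mul (contDiffAt_prod fun k _ =>
      (g.smooth φ _ _).contDiffAt (φ.1.open_target.mem_nhds hx))
  exact Complex.reCLM.contDiff.contDiffAt.comp x h

/-- The determinant of a Hermitian metric is multiplied by the squared absolute value of the
Jacobian determinant under a change of coordinates. -/
theorem HermitianMetric.det_transition (g : HermitianMetric m M) (φ ψ : atlas (Fin m → ℂ) M)
    {x : Fin m → ℂ} (hx : x ∈ (φ.1.symm.trans ψ.1).source) :
    (g.inChart φ x).det.re =
      ‖(LinearMap.toMatrix' (fderiv ℂ (fun y => ψ.1 (φ.1.symm y)) x :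
          (Fin m → ℂ) →ₗ[ℂ] _)).det‖ ^ 2 * (g.inChart ψ (ψ.1 (φ.1.symm x))).det.re := by
  set L := (fderiv ℂ (fun y => ψ.1 (φ.1.symm y)) x : (Fin m → ℂ) →ₗ[ℂ] (Fin m → ℂ)) with hL
  set A := LinearMap.toMatrix' L with hA
  have hLA (v : Fin m → ℂ) : fderiv ℂ (fun y => ψ.1 (φ.1.symm y)) x v = A.mulVec v := by
    rw [hA, ← Matrix.toLin'_apply, Matrix.toLin'_toMatrix']; rfl
  have e : g.inChart φ x = A.conjTranspose * g.inChart ψ (ψ.1 (φ.1.symm x)) * A := by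
    ext a b
    have := g.compat φ ψ x hx (Pi.single a 1) (Pi.single b 1)
    rw [hLA, hLA, Matrix.star_mulVec, ← Matrix.dotProduct_mulVec, Matrix.mulVec_mulVec,
      Matrix.mulVec_mulVec] at this
    have hs : star (Pi.single a 1 : Fin m → ℂ) = Pi.single a 1 := by
      rw [← Pi.single_star, star_one]
    rw [hs] at this
    simpa [Matrix.mul_assoc] using this
  rw [e, Matrix.det_mul, Matrix.det_mul, Matrix.det_conjTranspose]
  have h2 : star A.det * A.det = ((‖A.det‖ ^ 2 : ℝ) : ℂ) := by
    push_cast; exact Complex.conj_mul' _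
  rw [mul_right_comm, h2, Complex.re_ofReal_mul]

section AdjunctionPotential

variable {ι : M → CP (m + 1)}
  {f : MvPolynomial (Fin (m + 1 + 1)) ℂ}
  {σ : atlas (Fin m → ℂ) M → (Fin m → ℂ) → Fin (m + 1 + 1) → ℂ}

/-- The logarithm of the ratio of the metric on `K_M⁻¹` induced by `g` and the metric on
`𝒪(m + 2 - d)` induced by the standard Hermitian form, compared by the Poincaré residue. By the
adjunction formula it is the expression in charts of a global function on `M`. -/
def adjunctionPotential (d : ℕ) (f : MvPolynomial (Fin (m + 1 + 1)) ℂ)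
    (σ : atlas (Fin m → ℂ) M → (Fin m → ℂ) → Fin (m + 1 + 1) → ℂ) (g : HermitianMetric m M)
    (φ : atlas (Fin m → ℂ) M) (x : Fin m → ℂ) : ℝ :=
  Real.log (g.inChart φ x).det.re + (-1) * Real.log (‖residueCoeff f (σ φ) x‖ ^ 2) +
    ((m : ℝ) + 2 - d) * Real.log (sumNormSq (σ φ x))

variable (hσ : ∀ φ : atlas (Fin m → ℂ) M, IsImmersedLift ι φ.1 (σ φ))
  (hf : f.IsHomogeneous d) (hsmooth : IsSmoothHypersurface f)
  (hι : ∀ p, MvPolynomial.eval (ι p).rep f = 0)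

include hσ hf hsmooth hι

theorem contDiffAt_adjunctionPotential (g : HermitianMetric m M) (φ : atlas (Fin m → ℂ) M)
    {x : Fin m → ℂ} (hx : x ∈ φ.1.target) :
    ContDiffAt ℝ ∞ (adjunctionPotential d f σ g φ) x :=
  ((g.contDiffAt_log_det φ hx).add (contDiffAt_const.mul ((contDiffAt_log_norm_sq
    ((hσ φ).contDiffAt_residueCoeff hf hsmooth hι hx)
    ((hσ φ).residueCoeff_ne_zero hf hsmooth hι hx)).of_le (by simp)))).add
    (contDiffAt_const.mul ((contDiffAt_log_sumNormSq_comp ((hσ φ).contDiffAt hx)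
      ((hσ φ).ne_zero hx)).of_le (by simp)))

/-- The expression in charts of the first Chern form: `-(1/2π) i∂∂̄ log det g` is the sum of
`m + 2 - d` times the Fubini–Study form and an exact form, since the residue coefficient is
holomorphic. -/
theorem ddbarForm_log_det (g : HermitianMetric m M) (φ : atlas (Fin m → ℂ) M)
    {x : Fin m → ℂ} (hx : x ∈ φ.1.target) :
    ddbarForm (fun y => Real.log (g.inChart φ y).det.re) x =
      ddbarForm (adjunctionPotential d f σ g φ) x
        - ((m : ℝ) + 2 - d) • ddbarForm (fun y => Real.log (sumNormSq (σ φ y))) x := by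
  have h1 := g.contDiffAt_log_det φ hx
  have hr := (hσ φ).contDiffAt_residueCoeff hf hsmooth hι hx
  have hr0 := (hσ φ).residueCoeff_ne_zero hf hsmooth hι hx
  have h2 : ContDiffAt ℝ ∞ (fun y => Real.log (‖residueCoeff f (σ φ) y‖ ^ 2)) x :=
    (contDiffAt_log_norm_sq hr hr0).of_le (by simp)
  have h3 : ContDiffAt ℝ ∞ (fun y => Real.log (sumNormSq (σ φ y))) x :=
    (contDiffAt_log_sumNormSq_comp ((hσ φ).contDiffAt hx) ((hσ φ).ne_zero hx)).of_le (by simp)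
  have e : ddbarForm (adjunctionPotential d f σ g φ) x = _ :=
    ddbarForm_add (h1.add (contDiffAt_const.mul h2)) (contDiffAt_const.mul h3)
  rw [e, ddbarForm_add h1 (contDiffAt_const.mul h2), ddbarForm_const_mul _ h2,
    ddbarForm_log_norm_sq hr hr0, ddbarForm_const_mul _ h3]
  simp

end AdjunctionPotential

variable [IsManifold 𝓘(ℂ, Fin m → ℂ) ω M]

/-- The exterior derivative of a differential form on a complex manifold. -/
def extDerivForm {k : ℕ} (η : DiffForm m M k) : DiffForm m M (k + 1) :=
  ⟨fun φ x => extDeriv (η.1 φ) x, by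
    have hη (φ : atlas (Fin m → ℂ) M) {x : Fin m → ℂ} (hx : x ∈ φ.1.target) :
        ContDiffAt ℝ ∞ (η.1 φ) x := (η.2.1 φ).contDiffAt (φ.1.open_target.mem_nhds hx)
    refine ⟨fun φ x hx => ?_, fun φ ψ x hx => ?_⟩
    · exact (ContDiffAt.comp
        (g := ContinuousAlternatingMap.alternatizeUncurryFinCLM (n := k) ℝ (Fin m → ℂ) ℝ) x
        (ContinuousLinearMap.contDiff _).contDiffAt
        ((hη φ hx).fderiv_right (m := ∞) (by simp))).contDiffWithinAt
    · have hτ := (contDiffAt_transition φ ψ hx).restrict_scalars ℝ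
      have hx' : ψ.1 (φ.1.symm x) ∈ ψ.1.target := by
        simp only [OpenPartialHomeomorph.trans_source, OpenPartialHomeomorph.symm_source,
          Set.mem_inter_iff, Set.mem_preimage] at hx
        exact ψ.1.map_source hx.2
      have e : η.1 φ =ᶠ[𝓝 x] fun y => (η.1 ψ (ψ.1 (φ.1.symm y))).compContinuousLinearMap
          (fderiv ℝ (fun y => ψ.1 (φ.1.symm y)) y) := by
        filter_upwards [(φ.1.symm.trans ψ.1).open_source.mem_nhds hx] with y hy
        exact η.2.2 φ ψ y hy
      beta_reduce
      rw [e.extDeriv_eq]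
      exact extDeriv_pullback ((hη ψ hx').differentiableAt (by simp)) hτ (by simp)⟩

theorem extDerivForm_mem_closedForms (η : DiffForm m M 1) :
    extDerivForm η ∈ closedForms m M 2 := fun φ _ hx =>
  extDeriv_extDeriv_apply ((η.2.1 φ).contDiffAt (φ.1.open_target.mem_nhds hx)) two_le_infty

/-- Closed forms that differ by an exact form are cohomologous. -/
theorem deRhamClass_add_extDeriv (α : closedForms m M 2) (η : DiffForm m M 1) :
    deRhamClass (⟨extDerivForm η, extDerivForm_mem_closedForms η⟩ + α) = deRhamClass α := by
  refine (Submodule.Quotient.eq _).2 ?_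
  rw [add_sub_cancel_right]
  exact ⟨η, fun _ _ _ => rfl⟩

variable {ι : M → CP (m + 1)}
  {f : MvPolynomial (Fin (m + 1 + 1)) ℂ}
  {σ : atlas (Fin m → ℂ) M → (Fin m → ℂ) → Fin (m + 1 + 1) → ℂ}

variable (hσ : ∀ φ : atlas (Fin m → ℂ) M, IsImmersedLift ι φ.1 (σ φ)) (hd : 1 ≤ d)
  (hf : f.IsHomogeneous d) (hsmooth : IsSmoothHypersurface f)
  (hι : ∀ p, MvPolynomial.eval (ι p).rep f = 0)

include hσ hf hsmooth hι

include hd in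
theorem adjunctionPotential_transition (g : HermitianMetric m M) (φ ψ : atlas (Fin m → ℂ) M)
    {x : Fin m → ℂ} (hx : x ∈ (φ.1.symm.trans ψ.1).source) :
    adjunctionPotential d f σ g φ x = adjunctionPotential d f σ g ψ (ψ.1 (φ.1.symm x)) := by
  have hτ := contDiffAt_transition φ ψ hx
  obtain ⟨c, hc, e, b, hb⟩ := (hσ φ).fderiv_transition (hσ ψ) hx hτ
  have hR := (hσ φ).residueCoeff_transition hf hsmooth hι (hσ ψ) hx e hb
  have hG := g.det_transition φ ψ hx
  simp only [OpenPartialHomeomorph.trans_source, OpenPartialHomeomorph.symm_source,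
    Set.mem_inter_iff, Set.mem_preimage] at hx
  set D := (LinearMap.toMatrix' (fderiv ℂ (fun y => ψ.1 (φ.1.symm y)) x :
          (Fin m → ℂ) →ₗ[ℂ] _)).det with hD
  have hx' := ψ.1.map_source hx.2
  have hG1 := (g.det_pos φ hx.1).ne'
  have hG2 := (g.det_pos ψ hx').ne'
  have hD0 : ‖D‖ ^ 2 ≠ 0 := fun h0 => hG1 (by rw [hG, h0, zero_mul])
  have hR1 := (hσ φ).residueCoeff_ne_zero hf hsmooth hι hx.1
  have hR2 := (hσ ψ).residueCoeff_ne_zero hf hsmooth hι hx'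
  have hcn : ‖c‖ ≠ 0 := norm_ne_zero_iff.2 hc
  have hRn1 := norm_ne_zero_iff.2 hR1
  have hRn2 := norm_ne_zero_iff.2 hR2
  have hDn : ‖D‖ ≠ 0 := fun h0 => hD0 (by simp [h0])
  have hN := (sumNormSq_pos ((hσ φ).ne_zero hx.1)).ne'
  have hlog := congrArg (fun z => Real.log ‖z‖) hR
  simp only [norm_mul, norm_pow] at hlog
  rw [Real.log_mul (mul_ne_zero hDn hRn2) (pow_ne_zero _ hcn), Real.log_mul hDn hRn2,
    Real.log_mul (pow_ne_zero _ hcn) hRn1, Real.log_pow, Real.log_pow, Nat.cast_sub hd] at hlog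
  simp only [adjunctionPotential]
  rw [hG, e, sumNormSq_smul, Real.log_mul hD0 hG2, Real.log_mul (by positivity) hN]
  simp only [Real.log_pow]
  push_cast at hlog ⊢
  linear_combination 2 * hlog

/-- The global 1-form whose differential is the difference of the first Chern form and the multiple
of the Fubini–Study form. -/
def adjunctionForm (hd : 1 ≤ d) (g : HermitianMetric m M) : DiffForm m M 1 :=
  ⟨fun φ x => (-(1 / (2 * Real.pi))) • dcForm (adjunctionPotential d f σ g φ) x, by
    refine ⟨fun φ x hx => ?_, fun φ ψ x hx => ?_⟩
    · exact ((contDiffAt_dcForm (contDiffAt_adjunctionPotential hσ hf hsmooth hι g φ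
        hx)).const_smul _).contDiffWithinAt
    · have hτ := contDiffAt_transition φ ψ hx
      have hx' : ψ.1 (φ.1.symm x) ∈ ψ.1.target := by
        simp only [OpenPartialHomeomorph.trans_source, OpenPartialHomeomorph.symm_source,
          Set.mem_inter_iff, Set.mem_preimage] at hx
        exact ψ.1.map_source hx.2
      have e : adjunctionPotential d f σ g φ =ᶠ[𝓝 x]
          fun y => adjunctionPotential d f σ g ψ (ψ.1 (φ.1.symm y)) := by
        filter_upwards [(φ.1.symm.trans ψ.1).open_source.mem_nhds hx] with y hy
        exact adjunctionPotential_transition hσ hd hf hsmooth hι g φ ψ hy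
      beta_reduce
      rw [(dcForm_congr e).self_of_nhds, dcForm_comp (h := fun y => ψ.1 (φ.1.symm y))
        ((contDiffAt_adjunctionPotential hσ hf hsmooth hι g ψ hx').differentiableAt (by simp))
        (hτ.differentiableAt (by simp))]
      rfl⟩

include hd in
/-- The adjunction formula `c₁(T_M) = (m + 2 - d) H`. -/
theorem isFirstChernClass_fubiniStudyForm :
    IsFirstChernClass (((m : ℝ) + 2 - d) • deRhamClass (fubiniStudyForm hσ)) := by
  refine ⟨⟨fubiniStudyMetric hσ⟩, fun g => ?_⟩
  set η := adjunctionForm hσ hf hsmooth hι hd g with hη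
  set k : ℝ := (m : ℝ) + 2 - d with hk
  have hd2 (φ : atlas (Fin m → ℂ) M) (x : Fin m → ℂ) : extDeriv (η.1 φ) x =
      (-(1 / (2 * Real.pi))) • ddbarForm (adjunctionPotential d f σ g φ) x := extDeriv_smul _ _
  have hval (φ : atlas (Fin m → ℂ) M) {x : Fin m → ℂ} (hx : x ∈ φ.1.target) :
      (-(1 / (2 * Real.pi))) • ddbarForm (fun y => Real.log (g.inChart φ y).det.re) x =
        extDeriv (η.1 φ) x + k • (fubiniStudyForm hσ).1.1 φ x := by
    rw [hd2, ddbarForm_log_det hσ hf hsmooth hι g φ hx]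
    change _ = _ + k • ((1 / (2 * Real.pi)) • _)
    module
  refine ⟨⟨extDerivForm η, extDerivForm_mem_closedForms η⟩ + k • fubiniStudyForm hσ,
    fun φ x hx v w => ?_, ?_⟩
  · rw [iddbar_eq_ddbarForm (g.contDiffAt_log_det φ hx)]
    exact (congrArg (fun β => β ![v, w]) (hval φ hx)).symm
  · rw [deRhamClass_add_extDeriv]
    rfl

end ChernClass

/-! ### Topology of projective space and of hypersurfaces -/

section Topology

variable {n : ℕ}

/-- The matrix `z z* / |z|²` of the orthogonal projection onto the line through `z`. -/
def CP.projectionMatrix (p : CP n) (i j : Fin (n + 1)) : ℂ :=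
  p.rep i * star (p.rep j) / sumNormSq p.rep

theorem CP.projectionMatrix_mk (v : Fin (n + 1) → ℂ) (hv : v ≠ 0) (i j : Fin (n + 1)) :
    CP.projectionMatrix (Projectivization.mk ℂ v hv) i j = v i * star (v j) / sumNormSq v := by
  obtain ⟨a, ha, h⟩ := CP.rep_mk v hv
  have h2 : a * star a = (‖a‖ : ℂ) ^ 2 := Complex.mul_conj' a
  have h3 : (‖a‖ : ℂ) ^ 2 ≠ 0 := by simpa using ha
  have h4 : a * v i * star (a * v j) = (‖a‖ : ℂ) ^ 2 * (v i * star (v j)) := by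
    rw [star_mul', ← h2]; ring
  rw [CP.projectionMatrix, h, sumNormSq_smul, Pi.smul_apply, Pi.smul_apply, smul_eq_mul,
    smul_eq_mul, h4]
  push_cast
  rw [mul_div_mul_left _ _ h3]

theorem CP.continuous_projectionMatrix : Continuous (CP.projectionMatrix (n := n)) := by
  rw [(CP.isQuotientMap_mk n).continuous_iff]
  refine continuous_pi fun i => continuous_pi fun j => ?_
  have h : Continuous fun v : {v : Fin (n + 1) → ℂ // v ≠ 0} =>
      v.1 i * star (v.1 j) / (sumNormSq v.1 : ℂ) := by
    have hv : Continuous fun v : {v : Fin (n + 1) → ℂ // v ≠ 0} => v.1 := continuous_subtype_val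
    refine Continuous.div (((continuous_apply i).comp hv).mul
      (continuous_star.comp ((continuous_apply j).comp hv)))
      (Complex.continuous_ofReal.comp (contDiff_sumNormSq.continuous.comp hv)) fun v => ?_
    exact_mod_cast (sumNormSq_pos v.2).ne'
  exact h.congr fun v => (CP.projectionMatrix_mk v.1 v.2 i j).symm

theorem CP.projectionMatrix_injective : Function.Injective (CP.projectionMatrix (n := n)) := by
  intro p q h
  rw [← p.mk_rep, ← q.mk_rep, Projectivization.mk_eq_mk_iff']
  obtain ⟨j, hj⟩ := p.exists_rep_ne_zero
  have hp : (sumNormSq p.rep : ℂ) ≠ 0 := by exact_mod_cast (sumNormSq_pos p.rep_nonzero).ne'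
  have hj' : star (p.rep j) ≠ 0 := star_ne_zero.2 hj
  refine ⟨star (q.rep j) / sumNormSq q.rep * (sumNormSq p.rep / star (p.rep j)), ?_⟩
  ext i
  have hi := congrFun (congrFun h i) j
  simp only [CP.projectionMatrix] at hi
  rw [div_eq_iff hp] at hi
  rw [Pi.smul_apply, smul_eq_mul]
  field_simp
  linear_combination -hi

instance CP.instT2Space : T2Space (CP n) :=
  .of_injective_continuous CP.projectionMatrix_injective CP.continuous_projectionMatrix

instance CP.instCompactSpace : CompactSpace (CP n) := by
  have hne (v : Metric.sphere (0 : Fin (n + 1) → ℂ) 1) : v.1 ≠ 0 :=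
    ne_zero_of_mem_unit_sphere v
  have hc : Continuous fun v : Metric.sphere (0 : Fin (n + 1) → ℂ) 1 =>
      (Projectivization.mk ℂ v.1 (hne v) : CP n) :=
    (CP.isQuotientMap_mk n).continuous.comp (continuous_subtype_val.subtype_mk hne)
  refine Function.Surjective.compactSpace (f := fun v : Metric.sphere (0 : Fin (n + 1) → ℂ) 1 =>
      (Projectivization.mk ℂ v.1 (hne v) : CP n)) hc (fun p => ?_)
  have h0 : ‖p.rep‖ ≠ 0 := norm_ne_zero_iff.2 p.rep_nonzero
  refine ⟨⟨((‖p.rep‖⁻¹ : ℝ) : ℂ) • p.rep, by simp [norm_smul, h0]⟩, ?_⟩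
  conv_rhs => rw [← p.mk_rep]
  exact (Projectivization.mk_eq_mk_iff' ℂ _ _ _ _).2 ⟨((‖p.rep‖⁻¹ : ℝ) : ℂ), rfl⟩

variable {d : ℕ} {f : MvPolynomial (Fin (n + 1)) ℂ}

theorem eval_rep_mk_eq_zero_iff (hf : f.IsHomogeneous d) (v : Fin (n + 1) → ℂ) (hv : v ≠ 0) :
    MvPolynomial.eval (Projectivization.mk ℂ v hv).rep f = 0 ↔ MvPolynomial.eval v f = 0 := by
  obtain ⟨a, ha, h⟩ := CP.rep_mk v hv
  simp [h, eval_smul_of_isHomogeneous hf, ha]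

theorem isClosed_projectiveHypersurface (hf : f.IsHomogeneous d) :
    IsClosed (projectiveHypersurface f) := by
  rw [← (CP.isQuotientMap_mk n).isClosed_preimage]
  have : (Projectivization.mk' ℂ : {v : Fin (n + 1) → ℂ // v ≠ 0} → CP n) ⁻¹'
      projectiveHypersurface f = {v | MvPolynomial.eval v.1 f = 0} := by
    ext v
    exact eval_rep_mk_eq_zero_iff hf v.1 v.2
  rw [this]
  exact isClosed_eq ((contDiff_eval f).continuous.comp continuous_subtype_val) continuous_const

/-- Restricting `f` to a line in `ℙⁿ` gives a binary form, which has a zero: either the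
dehomogenization has a root, or it is constant and `f` vanishes at infinity. -/
theorem nonempty_projectiveHypersurface {m : ℕ} {f : MvPolynomial (Fin (m + 1 + 1)) ℂ}
    (hd : 1 ≤ d) (hf : f.IsHomogeneous d) : (projectiveHypersurface f).Nonempty := by
  suffices h : ∃ v : Fin (m + 1 + 1) → ℂ, v ≠ 0 ∧ MvPolynomial.eval v f = 0 by
    obtain ⟨v, hv, h⟩ := h
    exact ⟨Projectivization.mk ℂ v hv, (eval_rep_mk_eq_zero_iff hf v hv).2 h⟩
  set e₀ : Fin (m + 1 + 1) → ℂ := Pi.single 0 1 with he₀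
  set e₁ : Fin (m + 1 + 1) → ℂ := Pi.single 1 1 with he₁
  have h01 (t : ℂ) : e₀ + t • e₁ ≠ 0 := fun h => by
    simpa [he₀, he₁] using congrFun h 0
  have h10 : e₁ ≠ 0 := fun h => by simpa [he₁] using congrFun h 1
  set P : Polynomial ℂ := MvPolynomial.aeval
    (fun i => Polynomial.C (e₀ i) + Polynomial.X * Polynomial.C (e₁ i)) f with hP
  have hPeval (t : ℂ) : P.eval t = MvPolynomial.eval (e₀ + t • e₁) f := by
    rw [hP, ← Polynomial.coe_evalRingHom, MvPolynomial.aeval_def, MvPolynomial.hom_eval₂,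
      ← MvPolynomial.eval₂_id]
    congr 1
    · ext; simp
    · ext i; simp; exact mul_comm _ _
  by_cases hdeg : P.degree = 0
  · refine ⟨e₁, h10, ?_⟩
    obtain ⟨c, hc⟩ : ∃ c, P = Polynomial.C c := ⟨_, Polynomial.eq_C_of_degree_eq_zero hdeg⟩
    -- by homogeneity `f (s e₀ + e₁) = s ^ d c` for `s ≠ 0`, and `s` may tend to `0`
    have h1 (s : ℂ) (hs : s ≠ 0) : MvPolynomial.eval (s • e₀ + e₁) f = s ^ d * c := by
      have e : s • e₀ + e₁ = s • (e₀ + s⁻¹ • e₁) := by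
        rw [smul_add, smul_smul, mul_inv_cancel₀ hs, one_smul]
      rw [e, eval_smul_of_isHomogeneous hf, ← hPeval, hc, Polynomial.eval_C]
    have hcont : Continuous fun s : ℂ => MvPolynomial.eval (s • e₀ + e₁) f :=
      (contDiff_eval f).continuous.comp (by fun_prop)
    have h2 : (fun s : ℂ => MvPolynomial.eval (s • e₀ + e₁) f) = fun s => s ^ d * c :=
      Continuous.ext_on (dense_compl_singleton (0 : ℂ)) hcont (by fun_prop) fun s hs => h1 s hs
    have h3 := congrFun h2 0
    simpa [Nat.one_le_iff_ne_zero.1 hd] using h3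
  · obtain ⟨t, ht⟩ := Complex.isAlgClosed.exists_root P hdeg
    exact ⟨e₀ + t • e₁, h01 t, by rw [← hPeval]; exact ht⟩

end Topology

/-! ### Charts of a smooth hypersurface -/

section SliceChart

variable {m : ℕ} {X : Type*} [TopologicalSpace X]

theorem contDiff_insertNth {𝕜 : Type*} [NontriviallyNormedField 𝕜] (k : Fin (m + 1)) (c : 𝕜) :
    ContDiff 𝕜 ω (fun x : Fin m → 𝕜 => (k.insertNth c x : Fin (m + 1) → 𝕜)) := by
  refine contDiff_pi.2 fun j => Fin.succAboveCases k ?_ (fun l => ?_) j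
  · simpa using contDiff_const
  · simpa using contDiff_apply 𝕜 𝕜 l

theorem continuous_removeNth (k : Fin (m + 1)) :
    Continuous (fun w : Fin (m + 1) → ℂ => k.removeNth w) :=
  continuous_pi fun l => continuous_apply (k.succAbove l)

open Classical in
/-- If a subset `S` is the slice `x_k = 0` in the chart `C` of the ambient space, the remaining
coordinates form a chart of `S`. -/
def sliceChart {S : Set X} (C : OpenPartialHomeomorph X (Fin (m + 1) → ℂ)) (k : Fin (m + 1))
    (hS : ∀ q ∈ C.source, q ∈ S ↔ C q k = 0) (p : S) : OpenPartialHomeomorph S (Fin m → ℂ) :=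
  have key (x : Fin m → ℂ) (hx : k.insertNth (0 : ℂ) x ∈ C.target) :
      C.symm (k.insertNth (0 : ℂ) x) ∈ S :=
    (hS _ (C.map_target hx)).2 (by rw [C.right_inv hx]; simp)
  have key2 (q : S) (hq : q.1 ∈ C.source) : k.insertNth (0 : ℂ) (k.removeNth (C q)) = C q := by
    rw [← (hS q hq).1 q.2]
    simp
  { toFun := fun q => k.removeNth (C q)
    invFun := fun x =>
      if h : C.symm (k.insertNth (0 : ℂ) x) ∈ S then ⟨C.symm (k.insertNth (0 : ℂ) x), h⟩ else p
    source := Subtype.val ⁻¹' C.source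
    target := (fun x : Fin m → ℂ => (k.insertNth (0 : ℂ) x : Fin (m + 1) → ℂ)) ⁻¹' C.target
    map_source' := fun q hq => by
      rw [Set.mem_preimage, key2 q hq]
      exact C.map_source hq
    map_target' := fun x hx => by
      rw [dif_pos (key x hx)]
      exact C.map_target hx
    left_inv' := fun q hq => by
      have e : C.symm (k.insertNth (0 : ℂ) (k.removeNth (C q))) = q := by
        rw [key2 q hq, C.left_inv hq]
      rw [dif_pos (by rw [e]; exact q.2)]
      exact Subtype.ext e
    right_inv' := fun x hx => by
      rw [dif_pos (key x hx), C.right_inv hx]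
      simp
    open_source := C.open_source.preimage continuous_subtype_val
    open_target := C.open_target.preimage (contDiff_insertNth k 0).continuous
    continuousOn_toFun := (continuous_removeNth k).comp_continuousOn
      (C.continuousOn.comp continuous_subtype_val.continuousOn fun _ h => h)
    continuousOn_invFun := by
      rw [Topology.IsInducing.subtypeVal.continuousOn_iff]
      refine (C.continuousOn_symm.comp
        (contDiff_insertNth k 0).continuous.continuousOn fun _ h => h).congr fun x hx => ?_
      simp only [Function.comp]
      rw [dif_pos (key x hx)] }

variable {S : Set X} (C : OpenPartialHomeomorph X (Fin (m + 1) → ℂ)) (k : Fin (m + 1))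
    (hS : ∀ q ∈ C.source, q ∈ S ↔ C q k = 0) (p : S)

theorem sliceChart_symm_val {x : Fin m → ℂ} (hx : x ∈ (sliceChart C k hS p).target) :
    ((sliceChart C k hS p).symm x : X) = C.symm (k.insertNth (0 : ℂ) x) := by
  have h : C.symm (k.insertNth (0 : ℂ) x) ∈ S :=
    (hS _ (C.map_target hx)).2 (by rw [C.right_inv hx]; simp)
  exact congrArg Subtype.val (dif_pos h)

end SliceChart

section Straightening

variable {N : ℕ}

/-- The inverse function theorem for `w ↦ (w₁, …, F(w), …, w_N)`, with `F(w)` in place of `w_k`: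
near a point where `∂F/∂w_k ≠ 0` it is a holomorphic chart. -/
theorem exists_straightening {F : (Fin N → ℂ) → ℂ} (hF : ContDiff ℂ ω F) {k : Fin N}
    {w₀ : Fin N → ℂ} (h0 : fderiv ℂ F w₀ (Pi.single k 1) ≠ 0) :
    ∃ Ψ : OpenPartialHomeomorph (Fin N → ℂ) (Fin N → ℂ),
      Ψ ∈ contDiffGroupoid ω 𝓘(ℂ, Fin N → ℂ) ∧ w₀ ∈ Ψ.source ∧
      ∀ w, Ψ w = Function.update w k (F w) := by
  set Φ : (Fin N → ℂ) → (Fin N → ℂ) := fun w => w + (F w - w k) • Pi.single k 1 with hΦ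
  have hΦu (w) : Φ w = Function.update w k (F w) := by
    ext j
    by_cases hj : j = k
    · subst hj; simp [hΦ]
    · simp [hΦ, hj]
  have hsm : ContDiff ℂ ω Φ :=
    contDiff_id.add ((hF.sub (contDiff_apply ℂ ℂ k)).smul contDiff_const)
  set U : Set (Fin N → ℂ) := {w | fderiv ℂ F w (Pi.single k 1) ≠ 0} with hU
  have hUo : IsOpen U := isOpen_ne_fun
    ((hF.continuous_fderiv (by simp)).clm_apply continuous_const) continuous_const
  have hderiv (w) (hw : w ∈ U) : ∃ L : (Fin N → ℂ) ≃L[ℂ] (Fin N → ℂ),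
      HasFDerivAt Φ (L : (Fin N → ℂ) →L[ℂ] (Fin N → ℂ)) w := by
    set L : (Fin N → ℂ) →L[ℂ] (Fin N → ℂ) := ContinuousLinearMap.id ℂ _ +
      (fderiv ℂ F w - ContinuousLinearMap.proj k).smulRight (Pi.single k 1) with hL
    have hinj : Function.Injective (L : (Fin N → ℂ) →ₗ[ℂ] (Fin N → ℂ)) := by
      rw [← LinearMap.ker_eq_bot, LinearMap.ker_eq_bot']
      intro v hv
      replace hv : v + (fderiv ℂ F w v - v k) • (Pi.single k 1 : Fin N → ℂ) = 0 := hv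
      have hvk : v = v k • Pi.single k 1 := by
        ext j
        by_cases hj : j = k
        · subst hj; simp
        · simpa [hj] using congrFun hv j
      have hk := congrFun hv k
      simp only [Pi.add_apply, Pi.smul_apply, Pi.single_eq_same, smul_eq_mul, mul_one,
        add_sub_cancel, Pi.zero_apply] at hk
      rw [hvk, map_smul, smul_eq_mul] at hk
      rw [hvk, (mul_eq_zero.1 hk).resolve_right hw, zero_smul]
    refine ⟨(LinearEquiv.ofInjectiveEndo _ hinj).toContinuousLinearEquiv, ?_⟩
    have h1 : HasFDerivAt Φ L w :=
      (hasFDerivAt_id w).add (((hF.contDiffAt.differentiableAt (by simp)).hasFDerivAt.sub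
        (hasFDerivAt_apply k w)).smul_const _)
    exact h1
  obtain ⟨L₀, hL₀⟩ := hderiv w₀ h0
  set Ψ₀ := hsm.contDiffAt.toOpenPartialHomeomorph Φ hL₀ (by simp) with hΨ₀
  refine ⟨Ψ₀.restr U, ?_, ?_, hΦu⟩
  · refine mem_groupoid_of_pregroupoid.2 ⟨?_, ?_⟩
    · suffices h : ContDiffOn ℂ ω (Ψ₀.restr U) (Ψ₀.restr U).source by
        simpa [contDiffPregroupoid] using h
      exact hsm.contDiffOn
    · suffices h : ContDiffOn ℂ ω (Ψ₀.restr U).symm (Ψ₀.restr U).target by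
        simpa [contDiffPregroupoid] using h
      intro y hy
      have hyU : (Ψ₀.restr U).symm y ∈ U := by
        have := (Ψ₀.restr U).map_target hy
        rw [Ψ₀.restr_source' U hUo] at this
        exact this.2
      obtain ⟨L, hL⟩ := hderiv _ hyU
      exact ((Ψ₀.restr U).contDiffAt_symm hy hL hsm.contDiffAt).contDiffWithinAt
  · rw [Ψ₀.restr_source' U hUo]
    exact ⟨hsm.contDiffAt.mem_toOpenPartialHomeomorph_source hL₀ (by simp), h0⟩

theorem trans_mem_maximalAtlas {H X : Type*} [TopologicalSpace H] [TopologicalSpace X]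
    [ChartedSpace H X] {G : StructureGroupoid H} [HasGroupoid X G]
    {e : OpenPartialHomeomorph X H} (he : e ∈ G.maximalAtlas X)
    {Ψ : OpenPartialHomeomorph H H} (hΨ : Ψ ∈ G) : e.trans Ψ ∈ G.maximalAtlas X := by
  refine mem_maximalAtlas_iff.2 fun e' he' => ?_
  obtain ⟨h1, h2⟩ := mem_maximalAtlas_iff.1 he e' he'
  constructor
  · rw [OpenPartialHomeomorph.trans_symm_eq_symm_trans_symm, OpenPartialHomeomorph.trans_assoc]
    exact G.trans (G.symm hΨ) h1
  · rw [← OpenPartialHomeomorph.trans_assoc]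
    exact G.trans h2 hΨ

end Straightening

section HypersurfaceCharts

variable {m d : ℕ} {f : MvPolynomial (Fin (m + 1 + 1)) ℂ}

/-- The equation of the hypersurface `{f = 0}` in the affine chart `z_i ≠ 0`. -/
def dehomogenize (f : MvPolynomial (Fin (m + 1 + 1)) ℂ) (i : Fin (m + 1 + 1))
    (w : Fin (m + 1) → ℂ) : ℂ :=
  MvPolynomial.eval (i.insertNth (1 : ℂ) w : Fin (m + 1 + 1) → ℂ) f

theorem contDiff_dehomogenize (f : MvPolynomial (Fin (m + 1 + 1)) ℂ) (i : Fin (m + 1 + 1)) :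
    ContDiff ℂ ω (dehomogenize f i) :=
  (contDiff_eval f).comp (contDiff_insertNth i 1)

theorem fderiv_dehomogenize (f : MvPolynomial (Fin (m + 1 + 1)) ℂ) (i : Fin (m + 1 + 1))
    (w : Fin (m + 1) → ℂ) (k : Fin (m + 1)) :
    fderiv ℂ (dehomogenize f i) w (Pi.single k 1) =
      polyGrad f (i.insertNth (1 : ℂ) w : Fin (m + 1 + 1) → ℂ) (i.succAbove k) := by
  have h1 : HasFDerivAt (fun w : Fin (m + 1) → ℂ => (i.insertNth (1 : ℂ) w : Fin (m + 1 + 1) → ℂ))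
      (fderiv ℂ (fun w => (i.insertNth (1 : ℂ) w : Fin (m + 1 + 1) → ℂ)) w) w :=
    ((contDiff_insertNth i 1).contDiffAt.differentiableAt (by simp)).hasFDerivAt
  have h2 : fderiv ℂ (fun w : Fin (m + 1) → ℂ => (i.insertNth (1 : ℂ) w : Fin (m + 1 + 1) → ℂ)) w
      (Pi.single k 1) = Pi.single (i.succAbove k) 1 := by
    have hj (j) := congrArg (fun L => L (Pi.single k 1)) (hasFDerivAt_pi'.1 h1 j).fderiv
    ext j
    refine (hj j).symm.trans ?_
    refine Fin.succAboveCases i ?_ (fun l => ?_) j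
    · simp [Fin.ne_succAbove]
    · have : HasFDerivAt (𝕜 := ℂ) (fun w : Fin (m + 1) → ℂ => w l)
        (ContinuousLinearMap.proj (R := ℂ) (φ := fun _ => ℂ) l) w := hasFDerivAt_apply l w
      simp [this.fderiv, Pi.single_apply]
  have h3 : fderiv ℂ (dehomogenize f i) w = (fderiv ℂ (fun z => MvPolynomial.eval z f)
      (i.insertNth (1 : ℂ) w : Fin (m + 1 + 1) → ℂ)).comp _ :=
    fderiv_comp w ((contDiff_eval f).contDiffAt.differentiableAt (by simp)) h1.differentiableAt
  rw [h3, ContinuousLinearMap.comp_apply, h2, fderiv_eval, dotProduct_single, mul_one]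

theorem insertNth_chart (i : Fin (m + 1 + 1)) {p : CP (m + 1)} (hp : p.rep i ≠ 0) :
    (i.insertNth (1 : ℂ) (CP.chart i p) : Fin (m + 1 + 1) → ℂ) = (p.rep i)⁻¹ • p.rep := by
  ext j
  refine Fin.succAboveCases i ?_ (fun l => ?_) j
  · simp [hp]
  · simp [CP.chart, div_eq_inv_mul]

theorem mem_projectiveHypersurface_iff (hf : f.IsHomogeneous d) (i : Fin (m + 1 + 1))
    {p : CP (m + 1)} (hp : p.rep i ≠ 0) :
    p ∈ projectiveHypersurface f ↔ dehomogenize f i (CP.chart i p) = 0 := by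
  rw [dehomogenize, insertNth_chart i hp, eval_smul_of_isHomogeneous hf]
  simp [projectiveHypersurface, hp]

/-- At a smooth point some partial derivative of the affine equation does not vanish: by Euler's
identity the derivative in the dehomogenized direction is determined by the others. -/
theorem exists_fderiv_dehomogenize_ne_zero (hf : f.IsHomogeneous d)
    (hsmooth : IsSmoothHypersurface f) (i : Fin (m + 1 + 1)) (w : Fin (m + 1) → ℂ)
    (hw : dehomogenize f i w = 0) :
    ∃ k, fderiv ℂ (dehomogenize f i) w (Pi.single k 1) ≠ 0 := by
  by_contra! h
  simp only [fderiv_dehomogenize] at h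
  obtain ⟨j, hj⟩ := hsmooth _ (CP.insertNth_ne_zero i w) hw
  have he := polyGrad_dotProduct_self hf (i.insertNth (1 : ℂ) w : Fin (m + 1 + 1) → ℂ)
  change _ = _ * dehomogenize f i w at he
  rw [hw, mul_zero, dotProduct, Fin.sum_univ_succAbove _ i] at he
  simp only [h, zero_mul, Finset.sum_const_zero, add_zero, Fin.insertNth_apply_same, mul_one] at he
  revert hj
  refine Fin.succAboveCases i (fun hj => hj he) (fun l hj => hj (h l)) j

/-- Holomorphic coordinates of `ℙᵐ⁺¹` in which the hypersurface `{f = 0}` is given by `x_k = 0`: an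
affine chart, followed by the replacement of the coordinate `w_k` by the affine equation. -/
structure AdaptedChart (f : MvPolynomial (Fin (m + 1 + 1)) ℂ) where
  i : Fin (m + 1 + 1)
  k : Fin (m + 1)
  straighten : OpenPartialHomeomorph (Fin (m + 1) → ℂ) (Fin (m + 1) → ℂ)
  straighten_mem : straighten ∈ contDiffGroupoid ω 𝓘(ℂ, Fin (m + 1) → ℂ)
  straighten_apply : ∀ w, straighten w = Function.update w k (dehomogenize f i w)

namespace AdaptedChart

/-- The chart of the ambient projective space. -/
def ambient (C : AdaptedChart f) : OpenPartialHomeomorph (CP (m + 1)) (Fin (m + 1) → ℂ) :=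
  (CP.chart C.i).trans C.straighten

theorem rep_ne_zero (C : AdaptedChart f) {q : CP (m + 1)} (hq : q ∈ C.ambient.source) :
    q.rep C.i ≠ 0 :=
  ((CP.chart C.i).trans_source C.straighten ▸ hq).1

theorem ambient_mem_maximalAtlas (C : AdaptedChart f) :
    C.ambient ∈ IsManifold.maximalAtlas 𝓘(ℂ, Fin (m + 1) → ℂ) ω (CP (m + 1)) :=
  trans_mem_maximalAtlas (StructureGroupoid.subset_maximalAtlas _ (Set.mem_range_self C.i))
    C.straighten_mem

theorem mem_iff (hf : f.IsHomogeneous d) (C : AdaptedChart f) (q : CP (m + 1))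
    (hq : q ∈ C.ambient.source) : q ∈ projectiveHypersurface f ↔ C.ambient q C.k = 0 := by
  rw [mem_projectiveHypersurface_iff hf C.i (C.rep_ne_zero hq)]
  simp [ambient, C.straighten_apply]

theorem exists_mem_source (hf : f.IsHomogeneous d) (hsmooth : IsSmoothHypersurface f)
    (p : projectiveHypersurface f) : ∃ C : AdaptedChart f, p.1 ∈ C.ambient.source := by
  obtain ⟨i, hi⟩ := p.1.exists_rep_ne_zero
  obtain ⟨k, hk⟩ := exists_fderiv_dehomogenize_ne_zero hf hsmooth i _
    ((mem_projectiveHypersurface_iff hf i hi).1 p.2)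
  obtain ⟨Ψ, h1, h2, h3⟩ := exists_straightening (contDiff_dehomogenize f i) hk
  refine ⟨⟨i, k, Ψ, h1, h3⟩, ?_⟩
  rw [ambient, OpenPartialHomeomorph.trans_source]
  exact ⟨hi, h2⟩

/-- The chart of the hypersurface given by the coordinates other than `x_k`. -/
def slice (hf : f.IsHomogeneous d) (C : AdaptedChart f) (p : projectiveHypersurface f) :
    OpenPartialHomeomorph (projectiveHypersurface f) (Fin m → ℂ) :=
  sliceChart C.ambient C.k (C.mem_iff hf) p

/-- The affine parametrization `x ↦ (…, 1, …)` of the cone over the hypersurface in the chart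
`C.slice`. -/
def lift (C : AdaptedChart f) (x : Fin m → ℂ) : Fin (m + 1 + 1) → ℂ :=
  C.i.insertNth (1 : ℂ) (C.straighten.symm (C.k.insertNth (0 : ℂ) x))

theorem mem_straighten_target (hf : f.IsHomogeneous d) (C : AdaptedChart f)
    (p : projectiveHypersurface f) {x : Fin m → ℂ} (hx : x ∈ (C.slice hf p).target) :
    C.k.insertNth (0 : ℂ) x ∈ C.straighten.target := by
  have hx' : C.k.insertNth (0 : ℂ) x ∈ C.ambient.target := hx
  rw [ambient, OpenPartialHomeomorph.trans_target] at hx'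
  exact hx'.1

theorem isImmersedLift (hf : f.IsHomogeneous d) (C : AdaptedChart f)
    (p : projectiveHypersurface f) : IsImmersedLift Subtype.val (C.slice hf p) C.lift := by
  have hsm : ContDiffOn ℂ ω C.lift (C.slice hf p).target := by
    have h := contMDiffOn_of_mem_contDiffGroupoid
      ((contDiffGroupoid ω 𝓘(ℂ, Fin (m + 1) → ℂ)).symm C.straighten_mem)
    rw [contMDiffOn_iff_contDiffOn] at h
    exact (contDiff_insertNth C.i 1).comp_contDiffOn
      (h.comp (contDiff_insertNth C.k 0).contDiffOn fun x hx => C.mem_straighten_target hf p hx)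
  refine ⟨hsm, fun x hx => ?_, fun x hx v a h => ?_⟩
  · obtain ⟨c, hc, e⟩ := CP.rep_mk _ (CP.insertNth_ne_zero C.i
      (C.straighten.symm (C.k.insertNth (0 : ℂ) x)))
    refine ⟨c⁻¹, inv_ne_zero hc, ?_⟩
    rw [slice, sliceChart_symm_val _ _ _ _ hx]
    calc C.lift x = c⁻¹ • c • C.lift x := by rw [smul_smul, inv_mul_cancel₀ hc, one_smul]
      _ = _ := congrArg (c⁻¹ • ·) e.symm
  · have hd : HasFDerivAt C.lift (fderiv ℂ C.lift x) x := ((hsm.contDiffAt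
      ((C.slice hf p).open_target.mem_nhds hx)).differentiableAt (by simp)).hasFDerivAt
    have hj (j) := congrArg (fun L => L v) (hasFDerivAt_pi'.1 hd j).fderiv
    simp only [ContinuousLinearMap.comp_apply, h, ContinuousLinearMap.proj_apply,
      Pi.smul_apply, smul_eq_mul] at hj
    -- the coordinate `z_i` of the lift is constant, the others determine the coordinates `x`
    have ha : a = 0 := by
      have := hj C.i
      simpa [lift] using this.symm
    ext l
    have e : (fun y => C.lift y (C.i.succAbove (C.k.succAbove l))) =ᶠ[𝓝 x] fun y => y l := by
      filter_upwards [(C.slice hf p).open_target.mem_nhds hx] with y hy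
      have h1 := C.straighten.right_inv (C.mem_straighten_target hf p hy)
      rw [C.straighten_apply] at h1
      have h2 := congrFun h1 (C.k.succAbove l)
      rw [Function.update_of_ne (Fin.succAbove_ne _ _)] at h2
      simpa [lift] using h2
    have h3 : HasFDerivAt (𝕜 := ℂ) (fun w : Fin m → ℂ => w l)
      (ContinuousLinearMap.proj (R := ℂ) (φ := fun _ => ℂ) l) x := hasFDerivAt_apply l x
    have := hj (C.i.succAbove (C.k.succAbove l))
    rw [e.fderiv_eq, h3.fderiv, ha, zero_mul] at this
    exact this

end AdaptedChart

/-- A chart adapted to a point of a smooth hypersurface. -/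
def adaptedChartAt (hf : f.IsHomogeneous d) (hsmooth : IsSmoothHypersurface f)
    (p : projectiveHypersurface f) : AdaptedChart f :=
  (AdaptedChart.exists_mem_source hf hsmooth p).choose

/-- The atlas of a smooth hypersurface given by adapted charts. -/
@[reducible]
def hypersurfaceChartedSpace (hf : f.IsHomogeneous d) (hsmooth : IsSmoothHypersurface f) :
    ChartedSpace (Fin m → ℂ) (projectiveHypersurface f) where
  atlas := Set.range fun p => (adaptedChartAt hf hsmooth p).slice hf p
  chartAt p := (adaptedChartAt hf hsmooth p).slice hf p
  mem_chart_source p := (AdaptedChart.exists_mem_source hf hsmooth p).choose_spec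
  chart_mem_atlas p := Set.mem_range_self p

theorem isManifold_hypersurface (hf : f.IsHomogeneous d) (hsmooth : IsSmoothHypersurface f) :
    letI := hypersurfaceChartedSpace hf hsmooth
    IsManifold 𝓘(ℂ, Fin m → ℂ) ω (projectiveHypersurface f) := by
  let _ := hypersurfaceChartedSpace hf hsmooth
  refine isManifold_of_contDiffOn _ _ _ ?_
  rintro _ _ ⟨p, rfl⟩ ⟨q, rfl⟩
  set C := adaptedChartAt hf hsmooth p
  set D := adaptedChartAt hf hsmooth q
  -- the transition maps are restrictions of those of the ambient charts
  have h := contMDiffOn_of_mem_contDiffGroupoid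
    (StructureGroupoid.compatible_of_mem_maximalAtlas C.ambient_mem_maximalAtlas
      D.ambient_mem_maximalAtlas)
  rw [contMDiffOn_iff_contDiffOn] at h
  have hrem : ContDiff ℂ ω (fun w : Fin (m + 1) → ℂ => D.k.removeNth w) :=
    contDiff_pi.2 fun l => contDiff_apply ℂ ℂ (D.k.succAbove l)
  have hmaps (x : Fin m → ℂ) (hx : x ∈ ((C.slice hf p).symm.trans (D.slice hf q)).source) :
      C.k.insertNth (0 : ℂ) x ∈ (C.ambient.symm.trans D.ambient).source := by
    rw [OpenPartialHomeomorph.trans_source] at hx ⊢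
    refine ⟨hx.1, ?_⟩
    have h2 : ((C.slice hf p).symm x).1 ∈ D.ambient.source := hx.2
    rwa [AdaptedChart.slice, sliceChart_symm_val _ _ _ _ hx.1] at h2
  have key : ContDiffOn ℂ ω ((C.slice hf p).symm.trans (D.slice hf q))
      ((C.slice hf p).symm.trans (D.slice hf q)).source := by
    refine (hrem.comp_contDiffOn (h.comp (contDiff_insertNth C.k 0).contDiffOn hmaps)).congr ?_
    intro x hx
    rw [OpenPartialHomeomorph.trans_source] at hx
    change D.k.removeNth (D.ambient ((C.slice hf p).symm x).1) = _
    rw [AdaptedChart.slice, sliceChart_symm_val _ _ _ _ hx.1]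
    rfl
  simpa using key

/-- The isomorphism `ℂᵐ × ℂ ≃ ℂᵐ⁺¹` that inserts the second component as `k`-th coordinate. -/
def insertNthEquiv (k : Fin (m + 1)) : ((Fin m → ℂ) × ℂ) ≃L[ℂ] (Fin (m + 1) → ℂ) :=
  LinearEquiv.toContinuousLinearEquiv
    { toFun := fun y => k.insertNth y.2 y.1
      invFun := fun w => (k.removeNth w, w k)
      left_inv := fun y => by simp
      right_inv := fun w => by simp
      map_add' := fun y z => by
        ext j
        refine Fin.succAboveCases k ?_ (fun l => ?_) j <;> simp
      map_smul' := fun c y => by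
        ext j
        refine Fin.succAboveCases k ?_ (fun l => ?_) j <;> simp }

theorem isSmoothEmbedding_hypersurface (hf : f.IsHomogeneous d)
    (hsmooth : IsSmoothHypersurface f) :
    letI := hypersurfaceChartedSpace hf hsmooth
    Manifold.IsSmoothEmbedding 𝓘(ℂ, Fin m → ℂ) 𝓘(ℂ, Fin (m + 1) → ℂ) ω
        (Subtype.val : projectiveHypersurface f → CP (m + 1)) := by
  let _ := hypersurfaceChartedSpace hf hsmooth
  have := isManifold_hypersurface hf hsmooth
  refine ⟨Manifold.IsImmersionOfComplement.isImmersion (F := ℂ) fun p => ?_,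
    Topology.IsEmbedding.subtypeVal⟩
  set C := adaptedChartAt hf hsmooth p with hC
  have hp : p.1 ∈ C.ambient.source := (AdaptedChart.exists_mem_source hf hsmooth p).choose_spec
  refine Manifold.IsImmersionAtOfComplement.mk_of_charts (insertNthEquiv C.k) (C.slice hf p)
    C.ambient hp hp (IsManifold.subset_maximalAtlas (Set.mem_range_self p))
    C.ambient_mem_maximalAtlas (fun q hq => hq) fun x hx => ?_
  replace hx : x ∈ (C.slice hf p).target := by simpa using hx
  have hx' : C.k.insertNth (0 : ℂ) x ∈ C.ambient.target := hx
  change C.ambient ((C.slice hf p).symm x).1 = C.k.insertNth (0 : ℂ) x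
  rw [AdaptedChart.slice, sliceChart_symm_val _ _ _ _ hx, C.ambient.right_inv hx']

theorem exists_isImmersedLift_hypersurface (hf : f.IsHomogeneous d)
    (hsmooth : IsSmoothHypersurface f) :
    letI := hypersurfaceChartedSpace hf hsmooth
    ∀ φ : atlas (Fin m → ℂ) (projectiveHypersurface f),
      ∃ σ, IsImmersedLift (Subtype.val : projectiveHypersurface f → CP (m + 1)) φ.1 σ := by
  rintro ⟨_, p, rfl⟩
  exact ⟨_, (adaptedChartAt hf hsmooth p).isImmersedLift hf p⟩

theorem isCompactComplexManifold_hypersurface (hd : 1 ≤ d) (hf : f.IsHomogeneous d)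
    (hsmooth : IsSmoothHypersurface f) :
    letI := hypersurfaceChartedSpace hf hsmooth
    IsCompactComplexManifold m (projectiveHypersurface f) :=
  letI := hypersurfaceChartedSpace hf hsmooth
  { isManifold := isManifold_hypersurface hf hsmooth
    nonempty := (nonempty_projectiveHypersurface hd hf).to_subtype
    compactSpace := isCompact_iff_compactSpace.1 (isClosed_projectiveHypersurface hf).isCompact
    t2Space := inferInstance }

end HypersurfaceCharts

end

/-- A smooth hypersurface `M = {f = 0}` of degree `d` in `ℙⁿ`, `n = m + 1`, is a compact complex
submanifold of dimension `m = n - 1`, the Fubini–Study form restricts to a Kähler form on it, and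
`c₁(T_M) = (n + 1 - d) H`; if `d = n + 1`, then `M` is a Calabi–Yau `(n - 1)`-fold. -/
theorem mainTheorem1 (m d : ℕ) (hd : 1 ≤ d) (f : MvPolynomial (Fin (m + 1 + 1)) ℂ)
    (hf : f.IsHomogeneous d) (hsmooth : IsSmoothHypersurface f) :
    ∃ _ : ChartedSpace (Fin m → ℂ) (projectiveHypersurface f),
      IsCompactComplexManifold m (projectiveHypersurface f) ∧
      Manifold.IsSmoothEmbedding 𝓘(ℂ, Fin m → ℂ) 𝓘(ℂ, Fin (m + 1) → ℂ) ω
        (Subtype.val : projectiveHypersurface f → CP (m + 1)) ∧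
      (∃ (g : HermitianMetric m (projectiveHypersurface f))
          (H : closedForms m (projectiveHypersurface f) 2),
        IsFubiniStudyForm (Subtype.val : projectiveHypersurface f → CP (m + 1)) H.1 ∧
        g.IsFundamentalForm H.1 ∧
        IsFirstChernClass (((m : ℝ) + 2 - d) • deRhamClass H)) ∧
      (d = m + 2 → IsCalabiYau m (projectiveHypersurface f)) := by
  let _ := hypersurfaceChartedSpace hf hsmooth
  have := isManifold_hypersurface hf hsmooth
  have hM := isCompactComplexManifold_hypersurface hd hf hsmooth
  choose σ hσ using exists_isImmersedLift_hypersurface hf hsmooth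
  have hc := isFirstChernClass_fubiniStudyForm hσ hd hf hsmooth fun p => p.2
  refine ⟨inferInstance, hM, isSmoothEmbedding_hypersurface hf hsmooth,
    ⟨fubiniStudyMetric hσ, fubiniStudyForm hσ, isFubiniStudyForm_fubiniStudyForm hσ,
      isFundamentalForm_fubiniStudyForm hσ, hc⟩, fun hdm => ⟨hM, ⟨fubiniStudyMetric hσ,
      (fubiniStudyForm hσ).1, (fubiniStudyForm hσ).2, isFundamentalForm_fubiniStudyForm hσ⟩, ?_⟩⟩
  have h0 : (m : ℝ) + 2 - d = 0 := by rw [hdm]; push_cast; ring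
  rwa [h0, zero_smul] at hc
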